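/- **Setting.** Let $d\ge 1$. Let $\Phi:\mathbb R^d\to\mathbb R$ be continuous, radial and supported in the closed unit ball, with Fourier transform $\widehat\Phi(\omega)=(2\pi)^{-d/2}\int\Phi(x)e^{-i\langle x,\omega\rangle}\,dx$ satisfying $c_\Phi(1+\|\omega\|_2^2)^{-\tau}\le\widehat\Phi(\omega)\le C_\Phi(1+\|\omega\|_2^2)^{-\tau}$ for some $\tau>d/2$ and $c_\Phi,C_\Phi>0$; put $\Phi_\delta(x)=\delta^{-d}\Phi(x/\delta)$. Let $\Omega\subset\mathbb R^d$ be a bounded domain and, for each $\ell\ge1$, let $X_\ell=\{x^{(\ell)}_1,\dots,x^{(\ell)}_{N(\ell)}\}\subset\Omega$ be a set of $N(\ell)$ distinct points, with fill distance $h_\ell=\sup_{x\in\Omega}\min_j\|x-x^{(\ell)}_j\|_2$ and separation distance $q_\ell=\frac12\min_{j\ne k}\|x^{(\ell)}_j-x^{(\ell)}_k\|_2$. Suppose that for some $\mu\in(0,1)$ with $\mu^{-d}>2$, $c_h\in(0,1]$, $c_q$, $c_\#>0$, $\gamma$, and all $\ell\ge1$, $$c_h\mu h_\ell\le h_{\ell+1}\le\mu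 h_\ell,\qquad q_\ell\le h_\ell\le c_q q_\ell,\qquad c_\#\mu^{-d\ell}\le N(\ell),$$ and let $\delta_\ell=\nu h_\ell$ with $\nu>0$, $1/h_1\le\nu\le\gamma/\mu$. Let $A_\ell=\big(\Phi_{\delta_\ell}(x^{(\ell)}_i-x^{(\ell)}_j)\big)_{i,j}$, and for $L\ge1$ let $D_L=\operatorname{diag}(A_1,\dots,A_L)$ and $N=\sum_{\ell=1}^LN(\ell)$. Finally put $$M_d=12\Big(\tfrac{\pi\Gamma(d/2+1)^2}{9}\Big)^{\frac1{d+1}},\quad C_d=\tfrac{1}{2\Gamma(d/2+1)}\Big(\tfrac{M_d}{2^{3/2}}\Big)^d,\quad C=(C_dc_\Phi)^{-1}\big(1+4M_d^2\nu^2c_q^2\big)^\tau,\quad C_{cg}=4^dC .$$ **Theorem 3.6.** There is a constant $K$, depending only on $d$, $\nu$, $c_q$ and an upper bound for $\Phi(0)$, such that for all kernels, domains and point sets as above, all $L\ge1$ and all $\varepsilon\in(0,1)$ there is a number $k$ of steps with the following property. For every right-hand side $\beta\in\mathbb R^N$ and every starting vector $\alpha^{(0)}\in\mathbb R^N$, the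 system $D_L\alpha=\beta$ has a unique solution $\alpha^*$, and the blockwise conjugate gradient method ($k$ conjugate gradient steps, stopping earlier if the residual vanishes, on each of the systems $A_\ell\alpha_\ell=\beta_\ell$, $1\le\ell\le L$, started at $\alpha^{(0)}_\ell$, with the nonzero entries of $A_\ell$ stored row by row) returns a vector $\alpha$ with $$\|\alpha-\alpha^*\|_2\le\varepsilon\,\|\alpha^{(0)}-\alpha^*\|_2,$$ and its total number of real operations ($+,-,\times,/$, tests for zero) is at most $$K\,N\,\max\Big\{1,\Big\lceil\tfrac12\sqrt{C_{cg}}\,\log\Big(\frac{C\,\sqrt L\;q_1^{d/2}}{\varepsilon}\Big)\Big\rceil\Big\}.$$ -/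

import Mathlib

open scoped FourierTransform

noncomputable section

/-! ### Kernels -/

/-- Fourier transform in the unitary convention
`(2π)^(-d/2) ∫ f(x) exp(-i ⟨x, ω⟩) dx`, written through Mathlib's `𝓕`, which uses `exp(-2πi ⟨x, ω⟩)`. -/
def unitaryFourier {d : ℕ} (f : EuclideanSpace ℝ (Fin d) → ℝ)
    (ω : EuclideanSpace ℝ (Fin d)) : ℂ :=
  (((2 * Real.pi) ^ (-(d : ℝ) / 2) : ℝ) : ℂ) *
    𝓕 (fun x : EuclideanSpace ℝ (Fin d) => (f x : ℂ)) ((2 * Real.pi)⁻¹ • ω)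

/-- The kernel assumption: `Φ` is continuous, radial, supported in the closed unit ball, and its
Fourier transform (real valued, because `Φ` is even) lies between two multiples of
`(1 + ‖ω‖²)^(-τ)` with `τ > d/2`. -/
structure IsAdmissibleKernel {d : ℕ} (Φ : EuclideanSpace ℝ (Fin d) → ℝ) (τ cΦ CΦ : ℝ) : Prop where
  continuous : Continuous Φ
  radial : ∃ φ : ℝ → ℝ, ∀ x, Φ x = φ ‖x‖
  support_subset : tsupport Φ ⊆ Metric.closedBall 0 1
  tau_gt : (d : ℝ) / 2 < τ
  lower_pos : 0 < cΦ
  upper_pos : 0 < CΦ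
  fourier_lower : ∀ ω, cΦ * (1 + ‖ω‖ ^ 2) ^ (-τ) ≤ (unitaryFourier Φ ω).re
  fourier_upper : ∀ ω, (unitaryFourier Φ ω).re ≤ CΦ * (1 + ‖ω‖ ^ 2) ^ (-τ)

/-- The scaled kernel `Φ_δ(x) = δ^(-d) Φ(x/δ)`. -/
def scaledKernel {d : ℕ} (Φ : EuclideanSpace ℝ (Fin d) → ℝ) (δ : ℝ)
    (x : EuclideanSpace ℝ (Fin d)) : ℝ :=
  (δ ^ d)⁻¹ * Φ (δ⁻¹ • x)

/-! ### Point sets -/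

/-- The fill distance `sup_{x ∈ Ω} min_j ‖x - x_j‖` of a finite family of points. -/
def fillDist {d n : ℕ} (x : Fin n → EuclideanSpace ℝ (Fin d))
    (Ω : Set (EuclideanSpace ℝ (Fin d))) : ℝ :=
  ⨆ y : Ω, Metric.infDist (y : EuclideanSpace ℝ (Fin d)) (Set.range x)

/-- The separation distance `(1/2) min_{j ≠ k} ‖x_j - x_k‖` (for at least two points). -/
def sepDist {d n : ℕ} (x : Fin n → EuclideanSpace ℝ (Fin d)) : ℝ :=
  (1 / 2) * ⨅ p : {p : Fin n × Fin n // p.1 ≠ p.2}, dist (x p.1.1) (x p.1.2)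

/-- The assumptions on the hierarchy of point sets, on the levels `ℓ = 1, 2, …`, and on the
parameter `ν` of the kernel scalings `δ_ℓ = ν h_ℓ`. -/
structure IsAdmissibleHierarchy {d : ℕ} (Ω : Set (EuclideanSpace ℝ (Fin d))) (N : ℕ → ℕ)
    (X : (ℓ : ℕ) → Fin (N ℓ) → EuclideanSpace ℝ (Fin d)) (μ ch cq cs γ ν : ℝ) : Prop where
  isOpen : IsOpen Ω
  isConnected : IsConnected Ω
  isBounded : Bornology.IsBounded Ω
  mem : ∀ ℓ, 1 ≤ ℓ → ∀ i, X ℓ i ∈ Ω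
  injective : ∀ ℓ, 1 ≤ ℓ → Function.Injective (X ℓ)
  mu_mem : μ ∈ Set.Ioo (0 : ℝ) 1
  ch_mem : ch ∈ Set.Ioc (0 : ℝ) 1
  fill_lower : ∀ ℓ, 1 ≤ ℓ → ch * μ * fillDist (X ℓ) Ω ≤ fillDist (X (ℓ + 1)) Ω
  fill_upper : ∀ ℓ, 1 ≤ ℓ → fillDist (X (ℓ + 1)) Ω ≤ μ * fillDist (X ℓ) Ω
  sep_le_fill : ∀ ℓ, 1 ≤ ℓ → sepDist (X ℓ) ≤ fillDist (X ℓ) Ω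
  fill_le_sep : ∀ ℓ, 1 ≤ ℓ → fillDist (X ℓ) Ω ≤ cq * sepDist (X ℓ)
  cs_pos : 0 < cs
  card_lower : ∀ ℓ, 1 ≤ ℓ → cs * (μ ^ (d * ℓ))⁻¹ ≤ (N ℓ : ℝ)
  mu_pow : 2 < (μ ^ d)⁻¹
  nu_lower : 1 / fillDist (X 1) Ω ≤ ν
  nu_upper : ν ≤ γ / μ

/-! ### The block diagonal matrix -/

/-- The interpolation matrix `(Φ_δ(x_i - x_j))_{i,j}`. -/
def kernelMatrix {d n : ℕ} (Φ : EuclideanSpace ℝ (Fin d) → ℝ) (δ : ℝ)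
    (x : Fin n → EuclideanSpace ℝ (Fin d)) : Matrix (Fin n) (Fin n) ℝ :=
  Matrix.of fun i j => scaledKernel Φ δ (x i - x j)

/-- The block `A_ℓ`, with scaling parameter `δ_ℓ = ν h_ℓ`. -/
def levelMatrix {d : ℕ} (Φ : EuclideanSpace ℝ (Fin d) → ℝ) (Ω : Set (EuclideanSpace ℝ (Fin d)))
    {N : ℕ → ℕ} (X : (ℓ : ℕ) → Fin (N ℓ) → EuclideanSpace ℝ (Fin d)) (ν : ℝ) (ℓ : ℕ) :
    Matrix (Fin (N ℓ)) (Fin (N ℓ)) ℝ :=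
  kernelMatrix Φ (ν * fillDist (X ℓ) Ω) (X ℓ)

/-- The index set of the unknowns on the levels `1, …, L`; the element `ℓ : Fin L` stands for the
level `ℓ + 1`. -/
abbrev MultiIdx (N : ℕ → ℕ) (L : ℕ) : Type := Σ ℓ : Fin L, Fin (N (ℓ + 1))

/-- The block diagonal matrix `D_L = diag(A_1, …, A_L)`. -/
def blockMatrix {d : ℕ} (Φ : EuclideanSpace ℝ (Fin d) → ℝ) (Ω : Set (EuclideanSpace ℝ (Fin d)))
    {N : ℕ → ℕ} (X : (ℓ : ℕ) → Fin (N ℓ) → EuclideanSpace ℝ (Fin d)) (ν : ℝ) (L : ℕ) :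
    Matrix (MultiIdx N L) (MultiIdx N L) ℝ :=
  Matrix.blockDiagonal' fun ℓ : Fin L => levelMatrix Φ Ω X ν (ℓ + 1)

/-! ### Constants -/

/-- `M_d = 12 (π Γ(d/2+1)² / 9)^(1/(d+1))`. -/
def constM (d : ℕ) : ℝ :=
  12 * (Real.pi * Real.Gamma ((d : ℝ) / 2 + 1) ^ 2 / 9) ^ (1 / ((d : ℝ) + 1))

/-- `C_d = (1 / (2 Γ(d/2+1))) (M_d / 2^(3/2))^d`. -/
def constC (d : ℕ) : ℝ :=
  1 / (2 * Real.Gamma ((d : ℝ) / 2 + 1)) * (constM d / (2 : ℝ) ^ (3 / 2 : ℝ)) ^ d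

/-- `(C_d c_Φ)⁻¹ (1 + 4 M_d² ν² c_q²)^τ`. -/
def stabConst (d : ℕ) (cΦ τ ν cq : ℝ) : ℝ :=
  (constC d * cΦ)⁻¹ * (1 + 4 * constM d ^ 2 * ν ^ 2 * cq ^ 2) ^ τ

/-- `C_cg = 4^d (C_d c_Φ)⁻¹ (1 + 4 M_d² ν² c_q²)^τ`, the level-independent number that controls the
condition numbers of the blocks. -/
def cgConst (d : ℕ) (cΦ τ ν cq : ℝ) : ℝ :=
  4 ^ d * stabConst d cΦ τ ν cq

/-! ### Computations with a count of real operations -/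

/-- A result together with the number of real operations (`+`, `-`, `*`, `/`, tests for `0`) that
were carried out to obtain it. -/
structure Counted (α : Type) where
  val : α
  ops : ℕ

namespace Counted

instance : Monad Counted where
  pure a := ⟨a, 0⟩
  bind m f := ⟨(f m.val).val, m.ops + (f m.val).ops⟩

def add (x y : ℝ) : Counted ℝ := ⟨x + y, 1⟩

def sub (x y : ℝ) : Counted ℝ := ⟨x - y, 1⟩

def mul (x y : ℝ) : Counted ℝ := ⟨x * y, 1⟩

def div (x y : ℝ) : Counted ℝ := ⟨x / y, 1⟩

open Classical in
def isZero (x : ℝ) : Counted Bool := ⟨decide (x = 0), 1⟩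

/-- Compute the entries of a vector one after the other. -/
def tabulate {n : ℕ} (f : Fin n → Counted ℝ) : Counted (Fin n → ℝ) :=
  ⟨fun i => (f i).val, ∑ i, (f i).ops⟩

end Counted

/-! ### The conjugate gradient method -/

open Classical in
/-- Sparse row storage: for each row the list of its nonzero entries with their column index. -/
def sparseRows {n : ℕ} (A : Matrix (Fin n) (Fin n) ℝ) (i : Fin n) : List (Fin n × ℝ) :=
  ((List.finRange n).filter fun j => decide (A i j ≠ 0)).map fun j => (j, A i j)

/-- Product of a sparsely stored matrix with a vector. -/
def sparseMulVec {n : ℕ} (rows : Fin n → List (Fin n × ℝ)) (v : Fin n → ℝ) :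
    Counted (Fin n → ℝ) :=
  Counted.tabulate fun i =>
    (rows i).foldlM (fun s e => do
      let t ← Counted.mul e.2 (v e.1)
      Counted.add s t) 0

/-- Inner product of two vectors. -/
def countedDot {n : ℕ} (v w : Fin n → ℝ) : Counted ℝ :=
  (List.finRange n).foldlM (fun s i => do
    let t ← Counted.mul (v i) (w i)
    Counted.add s t) 0

/-- `v + a • w`. -/
def addScaled {n : ℕ} (v : Fin n → ℝ) (a : ℝ) (w : Fin n → ℝ) : Counted (Fin n → ℝ) :=
  Counted.tabulate fun i => do
    let t ← Counted.mul a (w i)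
    Counted.add (v i) t

/-- `v - a • w`. -/
def subScaled {n : ℕ} (v : Fin n → ℝ) (a : ℝ) (w : Fin n → ℝ) : Counted (Fin n → ℝ) :=
  Counted.tabulate fun i => do
    let t ← Counted.mul a (w i)
    Counted.sub (v i) t

/-- The variables of the method: the iterate, its residual, the search direction, and the square of
the norm of the residual. -/
structure CGState (n : ℕ) where
  sol : Fin n → ℝ
  res : Fin n → ℝ
  dir : Fin n → ℝ
  resSq : ℝ

def cgInit {n : ℕ} (rows : Fin n → List (Fin n × ℝ)) (b x₀ : Fin n → ℝ) : Counted (CGState n) := do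
  let q ← sparseMulVec rows x₀
  let r ← Counted.tabulate fun i => Counted.sub (b i) (q i)
  let rr ← countedDot r r
  pure ⟨x₀, r, r, rr⟩

/-- One step of the conjugate gradient method; nothing is done once the residual vanishes. -/
def cgStep {n : ℕ} (rows : Fin n → List (Fin n × ℝ)) (s : CGState n) : Counted (CGState n) := do
  let halt ← Counted.isZero s.resSq
  if halt then
    pure s
  else
    let q ← sparseMulVec rows s.dir
    let pq ← countedDot s.dir q
    let a ← Counted.div s.resSq pq
    let x ← addScaled s.sol a s.dir
    let r ← subScaled s.res a q
    let rr ← countedDot r r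
    let b ← Counted.div rr s.resSq
    let p ← addScaled r b s.dir
    pure ⟨x, r, p, rr⟩

/-- The state after `k` steps. -/
def cgRun {n : ℕ} (rows : Fin n → List (Fin n × ℝ)) (b x₀ : Fin n → ℝ) :
    ℕ → Counted (CGState n)
  | 0 => cgInit rows b x₀
  | k + 1 => do
    let s ← cgRun rows b x₀ k
    cgStep rows s

/-- The `k`-th conjugate gradient iterate for `A x = b` with starting vector `x₀`, and its cost. -/
def conjGrad {n : ℕ} (A : Matrix (Fin n) (Fin n) ℝ) (b x₀ : Fin n → ℝ) (k : ℕ) :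
    Counted (Fin n → ℝ) := do
  let s ← cgRun (sparseRows A) b x₀ k
  pure s.sol

/-- The blockwise conjugate gradient method for `D_L α = β`: for each level `ℓ`, `k` steps of the
conjugate gradient method for `A_ℓ α_ℓ = β_ℓ` with starting vector `α⁰_ℓ`. The cost is the sum of the
costs on all levels. -/
def blockConjGrad {d : ℕ} (Φ : EuclideanSpace ℝ (Fin d) → ℝ)
    (Ω : Set (EuclideanSpace ℝ (Fin d))) {N : ℕ → ℕ}
    (X : (ℓ : ℕ) → Fin (N ℓ) → EuclideanSpace ℝ (Fin d)) (ν : ℝ) (L : ℕ)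
    (β α₀ : MultiIdx N L → ℝ) (k : ℕ) : Counted (MultiIdx N L → ℝ) :=
  let run (ℓ : Fin L) := conjGrad (levelMatrix Φ Ω X ν (ℓ + 1))
    (fun i => β ⟨ℓ, i⟩) (fun i => α₀ ⟨ℓ, i⟩) k
  ⟨fun i => (run i.1).val i.2, ∑ ℓ, (run ℓ).ops⟩

end

/-! The system decouples into the blocks, so it suffices that all blocks have condition number at
most one common multiple of `stabConst` and rows of bounded length. A fixed number of conjugate
gradient steps then serves every level, and each step costs a constant times the number of unknowns.

Upper spectral bound and sparsity: the kernel is supported in the unit ball and δ is at most ν·cq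
times the separation distance. Comparing volumes of disjoint balls leaves at most (1 + ν·cq)^d
nonzero entries per row, each at most δ^(-d) Φ(0) in modulus because Φ has a nonnegative Fourier
transform (`kernelMatrix_upper_bound`, `length_sparseRows_le`).

Lower spectral bound (`kernelMatrix_lower_bound`): by Fourier inversion the quadratic form of a
block is the integral of a positive density against the squared modulus of an exponential sum. The
density is minorized by a multiple of (R² - ‖ξ‖²) ∏ sinc(πξ_i)^4, which is nonpositive outside the
ball of radius R and whose cosine transform is supported in a cube. After rescaling, the points are
so far apart that the form of the minorant is diagonal, and its value at the origin is positive for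
large R. The choice of R made from `constM` reproduces `stabConst`.

Convergence (`conjGrad_error_le`): the iterate minimizes the energy of the error over a shifted
Krylov space, so it can be compared with Chebyshev polynomials. This gives decay like exp(-k/√cond);
passing between the energy and Euclidean norms costs a factor √cond, which only enters the
logarithm.

Step count (`exists_step_bound`): the prescribed logarithm has C√L q₁^(d/2)/ε as argument. Since 1 ≤
ν h₁ ≤ ν·cq·q₁ and L ≥ 1, this argument is at least a constant times C/ε, so the logarithm is
comparable with the one needed, up to a bounded range that the maximum with 1 absorbs. -/

noncomputable section

/-! ### Cost and value of the elementary routines -/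

namespace Counted

theorem bind_val {α β : Type} (m : Counted α) (f : α → Counted β) :
    (m >>= f).val = (f m.val).val := rfl

theorem bind_ops {α β : Type} (m : Counted α) (f : α → Counted β) :
    (m >>= f).ops = m.ops + (f m.val).ops := rfl

theorem pure_val {α : Type} (a : α) : (pure a : Counted α).val = a := rfl

theorem pure_ops {α : Type} (a : α) : (pure a : Counted α).ops = 0 := rfl

theorem foldlM_val {α β : Type} (f : β → α → Counted β) (l : List α) (s : β) :
    (l.foldlM f s).val = l.foldl (fun s e => (f s e).val) s := by
  induction l generalizing s with
  | nil => rfl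
  | cons a l ih => rw [List.foldlM_cons, bind_val, ih, List.foldl_cons]

theorem foldlM_ops {α β : Type} (f : β → α → Counted β) (c : ℕ) (hf : ∀ s e, (f s e).ops = c)
    (l : List α) (s : β) : (l.foldlM f s).ops = c * l.length := by
  induction l generalizing s with
  | nil => rfl
  | cons a l ih => rw [List.foldlM_cons, bind_ops, ih, hf, List.length_cons]; ring

end Counted

theorem foldl_add_eq_sum {α : Type} (f : α → ℝ) (l : List α) (s : ℝ) :
    l.foldl (fun s e => s + f e) s = s + (l.map f).sum := by
  induction l generalizing s with
  | nil => simp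
  | cons a l ih => rw [List.foldl_cons, ih, List.map_cons, List.sum_cons]; ring

theorem sum_map_filter_ne_zero {α : Type} (l : List α) (f : α → ℝ) (p : α → Bool)
    (h : ∀ a, p a = false → f a = 0) : ((l.filter p).map f).sum = (l.map f).sum := by
  induction l with
  | nil => rfl
  | cons a l ih =>
    rw [List.filter_cons]
    split_ifs with hp
    · simp [ih]
    · simp [ih, h a (by simpa using hp)]

theorem sparseMulVec_val {n : ℕ} (A : Matrix (Fin n) (Fin n) ℝ) (v : Fin n → ℝ) :
    (sparseMulVec (sparseRows A) v).val = A.mulVec v := by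
  funext i
  refine (Counted.foldlM_val (fun s (e : Fin n × ℝ) => do
    let t ← Counted.mul e.2 (v e.1)
    Counted.add s t) (sparseRows A i) 0).trans ?_
  refine (foldl_add_eq_sum (fun e : Fin n × ℝ => e.2 * v e.1) _ 0).trans ?_
  rw [sparseRows, List.map_map, zero_add, sum_map_filter_ne_zero]
  · simp [Matrix.mulVec, dotProduct, List.sum_ofFn, ← List.ofFn_eq_map]
  · intro j hj
    have : A i j = 0 := by simpa using hj
    simp [this]

theorem countedDot_val {n : ℕ} (v w : Fin n → ℝ) : (countedDot v w).val = v ⬝ᵥ w := by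
  rw [countedDot, Counted.foldlM_val]
  refine (foldl_add_eq_sum (fun i => v i * w i) _ 0).trans ?_
  simp [dotProduct, List.sum_ofFn, ← List.ofFn_eq_map]

theorem addScaled_val {n : ℕ} (v w : Fin n → ℝ) (a : ℝ) : (addScaled v a w).val = v + a • w := rfl

theorem subScaled_val {n : ℕ} (v w : Fin n → ℝ) (a : ℝ) : (subScaled v a w).val = v - a • w := rfl

/-! ### Operation counts. -/

theorem countedDot_ops {n : ℕ} (v w : Fin n → ℝ) : (countedDot v w).ops = 2 * n := by
  rw [countedDot, Counted.foldlM_ops _ 2 (fun _ _ => rfl), List.length_finRange]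

theorem addScaled_ops {n : ℕ} (v w : Fin n → ℝ) (a : ℝ) : (addScaled v a w).ops = 2 * n := by
  change ∑ _i : Fin n, 2 = _
  simp [mul_comm]

theorem subScaled_ops {n : ℕ} (v w : Fin n → ℝ) (a : ℝ) : (subScaled v a w).ops = 2 * n := by
  change ∑ _i : Fin n, 2 = _
  simp [mul_comm]

theorem sparseMulVec_ops_le {n m : ℕ} (rows : Fin n → List (Fin n × ℝ))
    (hm : ∀ i, (rows i).length ≤ m) (v : Fin n → ℝ) : (sparseMulVec rows v).ops ≤ 2 * m * n := by
  calc (sparseMulVec rows v).ops = ∑ i : Fin n, 2 * (rows i).length :=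
        Finset.sum_congr (s₁ := Finset.univ) rfl fun i _ => Counted.foldlM_ops (fun s (e : Fin n × ℝ) => do
          let t ← Counted.mul e.2 (v e.1)
          Counted.add s t) 2 (fun _ _ => rfl) (rows i) 0
    _ ≤ ∑ _i : Fin n, 2 * m := Finset.sum_le_sum fun i _ => Nat.mul_le_mul_left 2 (hm i)
    _ = _ := by simp [mul_comm]

theorem cgInit_ops_le {n m : ℕ} (rows : Fin n → List (Fin n × ℝ))
    (hm : ∀ i, (rows i).length ≤ m) (b x₀ : Fin n → ℝ) :
    (cgInit rows b x₀).ops ≤ (2 * m + 3) * n := by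
  have h1 := sparseMulVec_ops_le rows hm x₀
  simp only [cgInit, Counted.bind_ops, countedDot_ops, Counted.pure_ops]
  have h2 : (Counted.tabulate fun i => Counted.sub (b i) ((sparseMulVec rows x₀).val i)).ops = n := by
    change ∑ _i : Fin n, 1 = _
    simp
  rw [h2]
  linarith

/-- The sparse product costs 2mn, the two inner products 4n, the three vector updates 6n. The zero
test and the two divisions are three further operations, absorbed in 3n because n ≥ 1. -/
theorem cgStep_ops_le {n m : ℕ} (hn : 1 ≤ n) (rows : Fin n → List (Fin n × ℝ))
    (hm : ∀ i, (rows i).length ≤ m) (s : CGState n) :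
    (cgStep rows s).ops ≤ (2 * m + 13) * n := by
  have h1 := sparseMulVec_ops_le rows hm s.dir
  have h2 : ∀ x : ℝ, (Counted.isZero x).ops = 1 := fun _ => rfl
  have h3 : ∀ x y : ℝ, (Counted.div x y).ops = 1 := fun _ _ => rfl
  rw [cgStep, Counted.bind_ops, h2]
  split_ifs
  · rw [Counted.pure_ops]
    nlinarith
  · simp only [Counted.bind_ops, countedDot_ops, addScaled_ops, subScaled_ops, h3,
      Counted.pure_ops]
    linarith

theorem conjGrad_ops_le {n m : ℕ} (hn : 1 ≤ n) (A : Matrix (Fin n) (Fin n) ℝ)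
    (hm : ∀ i, (sparseRows A i).length ≤ m) (b x₀ : Fin n → ℝ) (k : ℕ) :
    (conjGrad A b x₀ k).ops ≤ (k + 1) * ((2 * m + 13) * n) := by
  -- The additional 1 in k + 1 pays for the initialization.
  have key : (cgRun (sparseRows A) b x₀ k).ops ≤ (k + 1) * ((2 * m + 13) * n) := by
    induction k with
    | zero =>
      refine (cgInit_ops_le _ hm b x₀).trans ?_
      nlinarith
    | succ k ih =>
      have := cgStep_ops_le hn _ hm (cgRun (sparseRows A) b x₀ k).val
      rw [cgRun, Counted.bind_ops]
      linarith
  rw [conjGrad, Counted.bind_ops, Counted.pure_ops]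
  exact key

/-! ### The conjugate gradient recursion -/

/-- The state of the method after `k` steps. -/
def cgSeq {n : ℕ} (A : Matrix (Fin n) (Fin n) ℝ) (b x₀ : Fin n → ℝ) (k : ℕ) : CGState n :=
  (cgRun (sparseRows A) b x₀ k).val

section Recursion

variable {n : ℕ} (A : Matrix (Fin n) (Fin n) ℝ) (b x₀ : Fin n → ℝ)

theorem conjGrad_val (k : ℕ) : (conjGrad A b x₀ k).val = (cgSeq A b x₀ k).sol := rfl

theorem cgSeq_zero : cgSeq A b x₀ 0 =
    ⟨x₀, b - A.mulVec x₀, b - A.mulVec x₀, (b - A.mulVec x₀) ⬝ᵥ (b - A.mulVec x₀)⟩ := by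
  have h : (Counted.tabulate fun i =>
      Counted.sub (b i) ((sparseMulVec (sparseRows A) x₀).val i)).val = b - A.mulVec x₀ := by
    rw [sparseMulVec_val]; rfl
  simp only [cgSeq, cgRun, cgInit, Counted.bind_val, countedDot_val, Counted.pure_val, h]

theorem cgSeq_succ_of_eq_zero (k : ℕ) (h : (cgSeq A b x₀ k).resSq = 0) :
    cgSeq A b x₀ (k + 1) = cgSeq A b x₀ k := by
  change (cgStep (sparseRows A) (cgSeq A b x₀ k)).val = _
  have h' : (Counted.isZero (cgSeq A b x₀ k).resSq).val = true := by simp [Counted.isZero, h]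
  rw [cgStep, Counted.bind_val, if_pos h', Counted.pure_val]

/-- The step length. -/
def cgAlpha (k : ℕ) : ℝ :=
  (cgSeq A b x₀ k).resSq / ((cgSeq A b x₀ k).dir ⬝ᵥ A.mulVec (cgSeq A b x₀ k).dir)

/-- The factor in the update of the search direction. -/
def cgBeta (k : ℕ) : ℝ := (cgSeq A b x₀ (k + 1)).resSq / (cgSeq A b x₀ k).resSq

theorem cgSeq_succ (k : ℕ) (h : (cgSeq A b x₀ k).resSq ≠ 0) :
    (cgSeq A b x₀ (k + 1)).sol = (cgSeq A b x₀ k).sol + cgAlpha A b x₀ k • (cgSeq A b x₀ k).dir ∧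
    (cgSeq A b x₀ (k + 1)).res =
      (cgSeq A b x₀ k).res - cgAlpha A b x₀ k • A.mulVec (cgSeq A b x₀ k).dir ∧
    (cgSeq A b x₀ (k + 1)).resSq =
      (cgSeq A b x₀ (k + 1)).res ⬝ᵥ (cgSeq A b x₀ (k + 1)).res ∧
    (cgSeq A b x₀ (k + 1)).dir =
      (cgSeq A b x₀ (k + 1)).res + cgBeta A b x₀ k • (cgSeq A b x₀ k).dir := by
  have h' : ¬ (Counted.isZero (cgSeq A b x₀ k).resSq).val = true := by simp [Counted.isZero, h]
  have hd : ∀ x y : ℝ, (Counted.div x y).val = x / y := fun _ _ => rfl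
  have key : cgSeq A b x₀ (k + 1) = (cgStep (sparseRows A) (cgSeq A b x₀ k)).val := rfl
  rw [cgBeta]
  rw [cgStep, Counted.bind_val, if_neg h'] at key
  simp only [Counted.bind_val, countedDot_val, addScaled_val, subScaled_val, sparseMulVec_val, hd,
    Counted.pure_val] at key
  rw [key]
  exact ⟨rfl, rfl, rfl, rfl⟩

theorem cgSeq_resSq (k : ℕ) :
    (cgSeq A b x₀ k).resSq = (cgSeq A b x₀ k).res ⬝ᵥ (cgSeq A b x₀ k).res := by
  induction k with
  | zero => rw [cgSeq_zero]
  | succ k ih =>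
    by_cases h : (cgSeq A b x₀ k).resSq = 0
    · rw [cgSeq_succ_of_eq_zero A b x₀ k h, ih]
    · exact (cgSeq_succ A b x₀ k h).2.2.1

theorem cgSeq_res (k : ℕ) : (cgSeq A b x₀ k).res = b - A.mulVec (cgSeq A b x₀ k).sol := by
  induction k with
  | zero => rw [cgSeq_zero]
  | succ k ih =>
    by_cases h : (cgSeq A b x₀ k).resSq = 0
    · rw [cgSeq_succ_of_eq_zero A b x₀ k h, ih]
    · obtain ⟨h1, h2, -, -⟩ := cgSeq_succ A b x₀ k h
      rw [h1, h2, ih, Matrix.mulVec_add, Matrix.mulVec_smul]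
      abel

theorem cgSeq_eq_of_resSq_eq_zero {j k : ℕ} (hjk : j ≤ k) (h : (cgSeq A b x₀ j).resSq = 0) :
    cgSeq A b x₀ k = cgSeq A b x₀ j := by
  induction k, hjk using Nat.le_induction with
  | base => rfl
  | succ k _ ih => rw [cgSeq_succ_of_eq_zero A b x₀ k (by rw [ih, h]), ih]

end Recursion

/-! ### Orthogonality and optimality -/

section Optimality

variable {n : ℕ} {A : Matrix (Fin n) (Fin n) ℝ} {b x₀ : Fin n → ℝ}

theorem dotProduct_mulVec_comm (hA : A.IsHermitian) (v w : Fin n → ℝ) :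
    v ⬝ᵥ A.mulVec w = w ⬝ᵥ A.mulVec v := by
  have : A.transpose = A := by simpa [Matrix.IsHermitian, Matrix.conjTranspose_eq_transpose_of_trivial] using hA
  rw [Matrix.dotProduct_mulVec, ← Matrix.mulVec_transpose, this, dotProduct_comm]

/-- The relations feed each other, hence one joint induction. Nonzero earlier residuals keep all
denominators nonzero: the product of direction and residual is the squared residual, so the
direction cannot vanish. -/
theorem cg_orthogonality (hA : A.IsHermitian) (hpos : ∀ v : Fin n → ℝ, v ≠ 0 → 0 < v ⬝ᵥ A.mulVec v)
    (k : ℕ) (hk : ∀ j < k, (cgSeq A b x₀ j).resSq ≠ 0) :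
    (∀ j < k, (cgSeq A b x₀ j).dir ⬝ᵥ (cgSeq A b x₀ k).res = 0 ∧
      (cgSeq A b x₀ j).dir ⬝ᵥ A.mulVec (cgSeq A b x₀ k).dir = 0) ∧
    ∀ j ≤ k, (cgSeq A b x₀ j).dir ⬝ᵥ (cgSeq A b x₀ j).res = (cgSeq A b x₀ j).resSq := by
  induction k with
  | zero =>
    refine ⟨fun j hj => absurd hj (Nat.not_lt_zero j), fun j hj => ?_⟩
    rw [Nat.le_zero.mp hj, cgSeq_zero]
  | succ k ih =>
    obtain ⟨ih1, ih2⟩ := ih fun j hj => hk j (by omega)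
    have hR := hk k (by omega)
    obtain ⟨-, hr, hrr, hp⟩ := cgSeq_succ A b x₀ k hR
    have hpAp : ∀ j ≤ k, (cgSeq A b x₀ j).dir ⬝ᵥ A.mulVec (cgSeq A b x₀ j).dir ≠ 0 := by
      intro j hj
      refine (hpos _ fun h => ?_).ne'
      have := ih2 j hj
      rw [h, zero_dotProduct] at this
      exact hk j (by omega) this.symm
    have hpk := hpAp k le_rfl
    have hdr : ∀ j < k + 1, (cgSeq A b x₀ j).dir ⬝ᵥ (cgSeq A b x₀ (k + 1)).res = 0 := by
      intro j hj
      rw [hr, dotProduct_sub, dotProduct_smul, smul_eq_mul]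
      rcases Nat.lt_succ_iff_lt_or_eq.mp hj with hj | rfl
      · rw [(ih1 j hj).1, (ih1 j hj).2]; ring
      · rw [ih2 j le_rfl, cgAlpha]; field_simp; ring
    -- Each residual is a combination of its own direction and the preceding one, so orthogonality
    -- to directions passes to residuals.
    have hres : ∀ j < k + 1, (cgSeq A b x₀ j).res ⬝ᵥ (cgSeq A b x₀ (k + 1)).res = 0 := by
      intro j hj
      rcases j with _ | j
      · have := hdr 0 hj
        rw [cgSeq_zero] at this ⊢
        exact this
      · obtain ⟨-, -, -, hpj⟩ := cgSeq_succ A b x₀ j (hk j (by omega))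
        have h1 := hdr (j + 1) hj
        rw [hpj, add_dotProduct, smul_dotProduct, hdr j (by omega), smul_zero, add_zero] at h1
        exact h1
    refine ⟨fun j hj => ⟨hdr j hj, ?_⟩, fun j hj => ?_⟩
    · rw [hp, Matrix.mulVec_add, Matrix.mulVec_smul, dotProduct_add, dotProduct_smul, smul_eq_mul,
        dotProduct_mulVec_comm hA]
      have hRj := hk j hj
      obtain ⟨-, hrj, -, -⟩ := cgSeq_succ A b x₀ j hRj
      have hα : cgAlpha A b x₀ j ≠ 0 := div_ne_zero hRj (hpAp j (by omega))
      -- Up to the step length, A applied to a direction is the difference of consecutive residuals.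
      -- Thus only j = k gives a nonzero contribution, and `cgBeta` is the factor that cancels it.
      have hAd : (cgSeq A b x₀ (k + 1)).res ⬝ᵥ A.mulVec (cgSeq A b x₀ j).dir =
          (cgAlpha A b x₀ j)⁻¹ * ((cgSeq A b x₀ j).res ⬝ᵥ (cgSeq A b x₀ (k + 1)).res -
            (cgSeq A b x₀ (j + 1)).res ⬝ᵥ (cgSeq A b x₀ (k + 1)).res) := by
        rw [← sub_dotProduct, hrj, sub_sub_cancel, smul_dotProduct, smul_eq_mul,
          inv_mul_cancel_left₀ hα, dotProduct_comm]
      rw [hAd, hres j hj]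
      rcases Nat.lt_succ_iff_lt_or_eq.mp hj with hj' | rfl
      · rw [hres (j + 1) (by omega), (ih1 j hj').2]; ring
      · rw [← hrr, cgBeta, cgAlpha]
        field_simp
        ring
    · rcases Nat.le_succ_iff.mp hj with hj | rfl
      · exact ih2 j hj
      · rw [hp, add_dotProduct, smul_dotProduct, hdr k (by omega), hrr, smul_zero, add_zero]

/-- A maps the j-th direction to a multiple of the difference of two consecutive residuals, which
lies in the span of the directions up to j + 1. Each application of A therefore needs only one more
direction. -/
theorem cg_krylov (hA : A.IsHermitian) (hpos : ∀ v : Fin n → ℝ, v ≠ 0 → 0 < v ⬝ᵥ A.mulVec v)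
    (k : ℕ) (hk : ∀ j < k, (cgSeq A b x₀ j).resSq ≠ 0) (i : ℕ) (hi : i < k) :
    (A.mulVecLin ^ i) (b - A.mulVec x₀) ∈
      Submodule.span ℝ ((fun j => (cgSeq A b x₀ j).dir) '' Set.Iio (i + 1)) := by
  have hmem : ∀ j m, j < m → (cgSeq A b x₀ j).dir ∈
      Submodule.span ℝ ((fun j => (cgSeq A b x₀ j).dir) '' Set.Iio m) :=
    fun j m hj => Submodule.subset_span ⟨j, hj, rfl⟩
  have hres : ∀ j ≤ k, ∀ m, j < m → (cgSeq A b x₀ j).res ∈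
      Submodule.span ℝ ((fun j => (cgSeq A b x₀ j).dir) '' Set.Iio m) := by
    intro j hj m hm
    rcases j with _ | j
    · have := hmem 0 m hm
      rw [cgSeq_zero] at this ⊢
      exact this
    · obtain ⟨-, -, -, hp⟩ := cgSeq_succ A b x₀ j (hk j (by omega))
      rw [eq_sub_of_add_eq hp.symm]
      exact Submodule.sub_mem _ (hmem _ _ hm) (Submodule.smul_mem _ _ (hmem _ _ (by omega)))
  have hAdir : ∀ j < k, A.mulVec (cgSeq A b x₀ j).dir ∈
      Submodule.span ℝ ((fun j => (cgSeq A b x₀ j).dir) '' Set.Iio (j + 2)) := by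
    intro j hj
    have hRj := hk j hj
    obtain ⟨-, hr, -, -⟩ := cgSeq_succ A b x₀ j hRj
    have hα : cgAlpha A b x₀ j ≠ 0 := by
      refine div_ne_zero hRj (hpos _ fun h => ?_).ne'
      have := (cg_orthogonality hA hpos k hk).2 j hj.le
      rw [h, zero_dotProduct] at this
      exact hRj this.symm
    have : A.mulVec (cgSeq A b x₀ j).dir = (cgAlpha A b x₀ j)⁻¹ •
        ((cgSeq A b x₀ j).res - (cgSeq A b x₀ (j + 1)).res) := by
      rw [hr, sub_sub_cancel, smul_smul, inv_mul_cancel₀ hα, one_smul]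
    rw [this]
    exact Submodule.smul_mem _ _ (Submodule.sub_mem _ (hres j hj.le _ (by omega))
      (hres (j + 1) (by omega) _ (by omega)))
  induction i with
  | zero =>
    have := hmem 0 1 one_pos
    rw [cgSeq_zero] at this
    simpa using this
  | succ i ih =>
    rw [pow_succ', Module.End.mul_apply]
    have h1 := Submodule.mem_map_of_mem (f := A.mulVecLin) (ih (by omega))
    rw [Submodule.map_span] at h1
    refine Submodule.span_le.mpr ?_ h1
    rintro _ ⟨_, ⟨j, hj, rfl⟩, rfl⟩
    have hj' : j < i + 1 := hj
    refine Submodule.span_mono (Set.image_mono ?_) (hAdir j (by omega))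
    exact Set.Iio_subset_Iio (by omega)

theorem cg_sol_sub_mem (k : ℕ) (hk : ∀ j < k, (cgSeq A b x₀ j).resSq ≠ 0) :
    (cgSeq A b x₀ k).sol - x₀ ∈
      Submodule.span ℝ ((fun j => (cgSeq A b x₀ j).dir) '' Set.Iio k) := by
  induction k with
  | zero => simp [cgSeq_zero]
  | succ k ih =>
    rw [(cgSeq_succ A b x₀ k (hk k (by omega))).1, add_sub_right_comm]
    refine Submodule.add_mem _ (Submodule.span_mono (Set.image_mono ?_)
      (ih fun j hj => hk j (by omega))) (Submodule.smul_mem _ _ (Submodule.subset_span ?_))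
    · exact Set.Iio_subset_Iio (by omega)
    · exact ⟨k, by simp, rfl⟩

/-- Optimality by Pythagoras: the error is A-orthogonal to the span of the directions, and because
p(0) = 1 the vector p(A)(xs - x₀) differs from it by an element of that span. -/
theorem cg_energy_le (hA : A.IsHermitian) (hpos : ∀ v : Fin n → ℝ, v ≠ 0 → 0 < v ⬝ᵥ A.mulVec v)
    (xs : Fin n → ℝ) (hxs : A.mulVec xs = b) (k : ℕ) (p : Polynomial ℝ) (hp : p.natDegree ≤ k)
    (hp0 : p.eval 0 = 1) :
    (xs - (cgSeq A b x₀ k).sol) ⬝ᵥ A.mulVec (xs - (cgSeq A b x₀ k).sol) ≤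
      (Polynomial.aeval A.mulVecLin p) (xs - x₀) ⬝ᵥ
        A.mulVec ((Polynomial.aeval A.mulVecLin p) (xs - x₀)) := by
  have hnonneg : ∀ v : Fin n → ℝ, 0 ≤ v ⬝ᵥ A.mulVec v := by
    intro v
    by_cases hv : v = 0
    · simp [hv]
    · exact (hpos v hv).le
  set e := xs - (cgSeq A b x₀ k).sol with he
  have hAe : A.mulVec e = (cgSeq A b x₀ k).res := by
    rw [he, Matrix.mulVec_sub, hxs, cgSeq_res]
  by_cases hk : ∀ j < k, (cgSeq A b x₀ j).resSq ≠ 0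
  · set y := (Polynomial.aeval A.mulVecLin p) (xs - x₀) with hy
    have hmem : y - e ∈ Submodule.span ℝ ((fun j => (cgSeq A b x₀ j).dir) '' Set.Iio k) := by
      have h0 : A.mulVecLin (xs - x₀) = b - A.mulVec x₀ := by
        rw [Matrix.mulVecLin_apply, Matrix.mulVec_sub, hxs]
      -- Write p = `p.divX` · X + 1; one factor A turns the initial error into the initial residual.
      have hsplit : y = (Polynomial.aeval A.mulVecLin p.divX) (b - A.mulVec x₀) + (xs - x₀) := by
        have hc : p.coeff 0 = 1 := by rw [Polynomial.coeff_zero_eq_eval_zero, hp0]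
        rw [hy]
        conv_lhs => rw [← Polynomial.divX_mul_X_add p]
        rw [hc, map_add, map_mul, Polynomial.aeval_X, map_one, map_one,
          LinearMap.add_apply, Module.End.mul_apply, Module.End.one_apply, h0]
      have : y - e = (Polynomial.aeval A.mulVecLin p.divX) (b - A.mulVec x₀) +
          ((cgSeq A b x₀ k).sol - x₀) := by
        rw [hsplit, he]; abel
      rw [this]
      refine Submodule.add_mem _ ?_ (cg_sol_sub_mem k hk)
      rw [Polynomial.aeval_eq_sum_range, LinearMap.sum_apply]
      refine Submodule.sum_mem _ fun i hi => ?_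
      rw [LinearMap.smul_apply]
      by_cases hik : i < k
      · refine Submodule.smul_mem _ _ (Submodule.span_mono (Set.image_mono ?_)
          (cg_krylov hA hpos k hk i hik))
        exact Set.Iio_subset_Iio (by omega)
      · have : p.divX.coeff i = 0 := by
          rw [Polynomial.coeff_divX]
          exact Polynomial.coeff_eq_zero_of_natDegree_lt (by omega)
        rw [this, zero_smul]
        exact Submodule.zero_mem _
    have horth : (y - e) ⬝ᵥ A.mulVec e = 0 := by
      rw [hAe]
      refine Submodule.span_induction (p := fun v _ => v ⬝ᵥ (cgSeq A b x₀ k).res = 0)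
        ?_ ?_ ?_ ?_ hmem
      · rintro _ ⟨j, hj, rfl⟩
        exact ((cg_orthogonality hA hpos k hk).1 j hj).1
      · exact zero_dotProduct _
      · intro u v _ _ hu hv
        rw [add_dotProduct, hu, hv, add_zero]
      · intro c u _ hu
        rw [smul_dotProduct, hu, smul_zero]
    have hexp : y ⬝ᵥ A.mulVec y = e ⬝ᵥ A.mulVec e + (y - e) ⬝ᵥ A.mulVec (y - e) := by
      have h1 : y = e + (y - e) := by abel
      have h2 : e ⬝ᵥ A.mulVec (y - e) = 0 := by rw [dotProduct_mulVec_comm hA, horth]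
      conv_lhs => rw [h1]
      rw [Matrix.mulVec_add, dotProduct_add, add_dotProduct, add_dotProduct, h2, horth]
      ring
    rw [hexp]
    linarith [hnonneg (y - e)]
  -- The method has stopped early: the residual is zero and so is the energy of the error.
  · push Not at hk
    obtain ⟨j, hj, hj0⟩ := hk
    have h1 := cgSeq_eq_of_resSq_eq_zero A b x₀ hj.le hj0
    have h2 : (cgSeq A b x₀ k).res = 0 := by
      rw [h1]
      rw [cgSeq_resSq] at hj0
      exact dotProduct_self_eq_zero.mp hj0
    rw [hAe, h2, dotProduct_zero]
    exact hnonneg _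

end Optimality

end

noncomputable section

/-! ### Chebyshev polynomials and the convergence of the conjugate gradient method -/

theorem chebyshev_eval_half_add_inv (t : ℝ) (ht : t ≠ 0) (k : ℕ) :
    (Polynomial.Chebyshev.T ℝ k).eval ((t + t⁻¹) / 2) = (t ^ k + (t ^ k)⁻¹) / 2 := by
  induction k using Nat.twoStepInduction with
  | zero => simp
  | one => simp
  | more k ih1 ih2 =>
    push_cast at ih2 ⊢
    rw [Polynomial.Chebyshev.T_add_two]
    simp only [Polynomial.eval_sub, Polynomial.eval_mul, Polynomial.eval_ofNat, Polynomial.eval_X,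
      ih1, ih2]
    field_simp
    ring

/-- A polynomial of degree at most `k` with value `1` at `0` that is small on `[a, b]`. -/
theorem exists_residual_polynomial {a b : ℝ} (ha : 0 < a) (hab : a < b) (k : ℕ) :
    ∃ p : Polynomial ℝ, p.natDegree ≤ k ∧ p.eval 0 = 1 ∧
      ∀ x ∈ Set.Icc a b, |p.eval x| ≤ 2 * Real.exp (-(k / √(b / a))) := by
  set s := √(b / a) with hs
  have hs1 : 1 < s := by
    rw [hs, Real.lt_sqrt zero_le_one, one_pow, one_lt_div ha]
    exact hab
  have hs2 : s ^ 2 = b / a := Real.sq_sqrt (div_pos (ha.trans hab) ha).le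
  -- With this t, (t + t⁻¹)/2 is the image of 0 under the affine map `l` that takes [a, b] onto [-1,
  -- 1]. The polynomial is the Chebyshev polynomial composed with `l`, normalized by its value
  -- there, which is at least t^k/2.
  set t := (s + 1) / (s - 1) with ht
  have hsm : 0 < s - 1 := by linarith
  have ht0 : 0 < t := by positivity
  have hba : 0 < b - a := by linarith
  have hη : (b + a) / (b - a) = (t + t⁻¹) / 2 := by
    have hb : b = s ^ 2 * a := by rw [hs2]; field_simp
    have h3 : s ^ 2 - 1 ≠ 0 := by nlinarith
    rw [hb, ht, inv_div, show s ^ 2 * a + a = (s ^ 2 + 1) * a by ring,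
      show s ^ 2 * a - a = (s ^ 2 - 1) * a by ring, mul_div_mul_right _ _ ha.ne',
      show s ^ 2 - 1 = (s - 1) * (s + 1) by ring]
    field_simp
    ring
  set Tη := (Polynomial.Chebyshev.T ℝ k).eval ((b + a) / (b - a)) with hT
  have hTη : t ^ k / 2 ≤ Tη := by
    rw [hT, hη, chebyshev_eval_half_add_inv t ht0.ne']
    have : 0 < (t ^ k)⁻¹ := by positivity
    linarith
  have htk : 0 < t ^ k := by positivity
  have hTpos : 0 < Tη := lt_of_lt_of_le (by positivity) hTη
  set l : Polynomial ℝ := Polynomial.C (-2 / (b - a)) * Polynomial.X +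
    Polynomial.C ((b + a) / (b - a)) with hl
  have hleval : ∀ x, l.eval x = (b + a - 2 * x) / (b - a) := by
    intro x
    simp only [hl, Polynomial.eval_add, Polynomial.eval_mul, Polynomial.eval_C, Polynomial.eval_X]
    ring
  refine ⟨Polynomial.C Tη⁻¹ * (Polynomial.Chebyshev.T ℝ k).comp l, ?_, ?_, ?_⟩
  · refine (Polynomial.natDegree_C_mul_le _ _).trans (Polynomial.natDegree_comp_le.trans ?_)
    rw [Polynomial.Chebyshev.natDegree_T, Int.natAbs_natCast]
    calc k * l.natDegree ≤ k * 1 := Nat.mul_le_mul_left _ Polynomial.natDegree_linear_le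
      _ = k := mul_one k
  · rw [Polynomial.eval_mul, Polynomial.eval_C, Polynomial.eval_comp, hleval, mul_zero, sub_zero]
    exact inv_mul_cancel₀ hTpos.ne'
  · intro x hx
    rw [Polynomial.eval_mul, Polynomial.eval_C, Polynomial.eval_comp, abs_mul, abs_inv,
      abs_of_pos hTpos]
    have h1 : |(Polynomial.Chebyshev.T ℝ k).eval (l.eval x)| ≤ 1 := by
      refine Polynomial.Chebyshev.abs_eval_T_real_le_one k ?_
      rw [hleval, abs_le, le_div_iff₀ hba, div_le_iff₀ hba]
      constructor <;> linarith [hx.1, hx.2]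
    have h2 : Tη⁻¹ ≤ 2 * (t ^ k)⁻¹ := by
      calc Tη⁻¹ ≤ (t ^ k / 2)⁻¹ := inv_anti₀ (by positivity) hTη
        _ = _ := by rw [inv_div]; ring
    -- t⁻¹ = 1 - 2/(s + 1) ≤ exp(-2/(s + 1)), and 2/(s + 1) ≥ 1/s since s > 1.
    have h3 : t⁻¹ ≤ Real.exp (-(1 / s)) := by
      have h4 : t⁻¹ = -(2 / (s + 1)) + 1 := by rw [ht, inv_div]; field_simp; ring
      rw [h4]
      refine (Real.add_one_le_exp _).trans (Real.exp_le_exp.mpr (neg_le_neg ?_))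
      rw [div_le_div_iff₀ (by linarith) (by linarith)]
      linarith
    have h5 : (t ^ k)⁻¹ ≤ Real.exp (-(k / s)) := by
      rw [← inv_pow]
      calc (t⁻¹) ^ k ≤ Real.exp (-(1 / s)) ^ k := pow_le_pow_left₀ (by positivity) h3 k
        _ = _ := by rw [← Real.exp_nat_mul]; ring_nf
    calc Tη⁻¹ * |(Polynomial.Chebyshev.T ℝ k).eval (l.eval x)| ≤ Tη⁻¹ * 1 := by gcongr
      _ ≤ _ := by linarith

/-! ### Spectral decomposition and the error estimate. -/

section Spectral

variable {n : ℕ} {A : Matrix (Fin n) (Fin n) ℝ}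

theorem aeval_mulVecLin_eigenvector (hA : A.IsHermitian) (p : Polynomial ℝ) (i : Fin n) :
    (Polynomial.aeval A.mulVecLin p) (hA.eigenvectorBasis i).ofLp =
      p.eval (hA.eigenvalues i) • (hA.eigenvectorBasis i).ofLp := by
  have h : A.mulVecLin (hA.eigenvectorBasis i).ofLp =
      hA.eigenvalues i • (hA.eigenvectorBasis i).ofLp := by
    rw [Matrix.mulVecLin_apply]
    exact hA.mulVec_eigenvectorBasis i
  induction p using Polynomial.induction_on' with
  | add p q hp hq => rw [map_add, LinearMap.add_apply, hp, hq, Polynomial.eval_add, add_smul]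
  | monomial m c =>
    rw [Polynomial.aeval_monomial, Polynomial.eval_monomial, Module.End.mul_apply]
    have : (A.mulVecLin ^ m) (hA.eigenvectorBasis i).ofLp =
        hA.eigenvalues i ^ m • (hA.eigenvectorBasis i).ofLp := by
      induction m with
      | zero => simp
      | succ m ih => rw [pow_succ', Module.End.mul_apply, ih, map_smul, h, smul_smul, pow_succ]
    rw [this, Module.algebraMap_end_apply, smul_smul]

theorem sum_eigenvector_dotProduct_smul (hA : A.IsHermitian) (v : Fin n → ℝ) :
    v = ∑ i, ((hA.eigenvectorBasis i).ofLp ⬝ᵥ v) • (hA.eigenvectorBasis i).ofLp := by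
  have h := hA.eigenvectorBasis.sum_repr' (WithLp.toLp 2 v)
  have h2 := congrArg (fun w : EuclideanSpace ℝ (Fin n) => w.ofLp) h
  simp only [WithLp.ofLp_sum, WithLp.ofLp_smul] at h2
  refine h2.symm.trans (Finset.sum_congr rfl fun i _ => ?_)
  congr 1
  rw [EuclideanSpace.inner_eq_star_dotProduct, dotProduct_comm]
  simp

theorem eigenvector_dotProduct (hA : A.IsHermitian) (i j : Fin n) :
    (hA.eigenvectorBasis i).ofLp ⬝ᵥ (hA.eigenvectorBasis j).ofLp = if i = j then 1 else 0 := by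
  have h := orthonormal_iff_ite.mp hA.eigenvectorBasis.orthonormal i j
  rw [EuclideanSpace.inner_eq_star_dotProduct, dotProduct_comm] at h
  simpa using h

theorem sum_smul_eigenvector_dotProduct (hA : A.IsHermitian) (c e : Fin n → ℝ) :
    (∑ i, c i • (hA.eigenvectorBasis i).ofLp) ⬝ᵥ (∑ i, e i • (hA.eigenvectorBasis i).ofLp) =
      ∑ i, c i * e i := by
  simp only [sum_dotProduct, dotProduct_sum, smul_dotProduct, dotProduct_smul,
    eigenvector_dotProduct, smul_eq_mul]
  simp [mul_comm]

/-- In an orthonormal eigenbasis the energy of p(A)v is the sum of λ p(λ)² times squared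
coefficients; the two form bounds, tested on eigenvectors, place every λ in [a, b]. -/
theorem aeval_energy_le (hA : A.IsHermitian) {a b P : ℝ} (ha : 0 < a)
    (hlow : ∀ v : Fin n → ℝ, a * (v ⬝ᵥ v) ≤ v ⬝ᵥ A.mulVec v)
    (hup : ∀ v : Fin n → ℝ, v ⬝ᵥ A.mulVec v ≤ b * (v ⬝ᵥ v)) (p : Polynomial ℝ)
    (hp : ∀ x ∈ Set.Icc a b, |p.eval x| ≤ P) (v : Fin n → ℝ) :
    (Polynomial.aeval A.mulVecLin p) v ⬝ᵥ A.mulVec ((Polynomial.aeval A.mulVecLin p) v) ≤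
      b * P ^ 2 * (v ⬝ᵥ v) := by
  set c : Fin n → ℝ := fun i => (hA.eigenvectorBasis i).ofLp ⬝ᵥ v with hc
  have hv : v = ∑ i, c i • (hA.eigenvectorBasis i).ofLp := sum_eigenvector_dotProduct_smul hA v
  have hAv : ∀ i, A.mulVec (hA.eigenvectorBasis i).ofLp =
      hA.eigenvalues i • (hA.eigenvectorBasis i).ofLp := fun i => hA.mulVec_eigenvectorBasis i
  have hpv : (Polynomial.aeval A.mulVecLin p) v =
      ∑ i, (c i * p.eval (hA.eigenvalues i)) • (hA.eigenvectorBasis i).ofLp := by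
    conv_lhs => rw [hv]
    simp only [map_sum, map_smul, aeval_mulVecLin_eigenvector, smul_smul]
  have hApv : A.mulVec ((Polynomial.aeval A.mulVecLin p) v) =
      ∑ i, (c i * p.eval (hA.eigenvalues i) * hA.eigenvalues i) •
        (hA.eigenvectorBasis i).ofLp := by
    rw [hpv, ← Matrix.mulVecLin_apply]
    simp only [map_sum, map_smul, Matrix.mulVecLin_apply, hAv, smul_smul]
  have hvv : v ⬝ᵥ v = ∑ i, c i * c i := by
    conv_lhs => rw [hv]
    exact sum_smul_eigenvector_dotProduct hA c c
  have hmem : ∀ i, hA.eigenvalues i ∈ Set.Icc a b := by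
    intro i
    have h1 := hlow (hA.eigenvectorBasis i).ofLp
    have h2 := hup (hA.eigenvectorBasis i).ofLp
    rw [hAv, dotProduct_smul, eigenvector_dotProduct, if_pos rfl, smul_eq_mul] at h1 h2
    constructor <;> linarith
  rw [hApv, hpv, sum_smul_eigenvector_dotProduct, hvv, Finset.mul_sum]
  refine Finset.sum_le_sum fun i _ => ?_
  have h1 : p.eval (hA.eigenvalues i) ^ 2 ≤ P ^ 2 := by
    rw [← sq_abs]
    exact pow_le_pow_left₀ (abs_nonneg _) (hp _ (hmem i)) 2
  have h2 : hA.eigenvalues i * p.eval (hA.eigenvalues i) ^ 2 ≤ b * P ^ 2 :=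
    mul_le_mul (hmem i).2 h1 (sq_nonneg _) (ha.le.trans ((hmem i).1.trans (hmem i).2))
  nlinarith [mul_self_nonneg (c i)]

/-- The error of the conjugate gradient method in the Euclidean norm. -/
theorem conjGrad_error_le (hA : A.IsHermitian) {a b : ℝ} (ha : 0 < a) (hab : a < b)
    (hlow : ∀ v : Fin n → ℝ, a * (v ⬝ᵥ v) ≤ v ⬝ᵥ A.mulVec v)
    (hup : ∀ v : Fin n → ℝ, v ⬝ᵥ A.mulVec v ≤ b * (v ⬝ᵥ v))
    (rhs x₀ xs : Fin n → ℝ) (hxs : A.mulVec xs = rhs) {ε : ℝ} (hε : 0 < ε) (k : ℕ)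
    (hk : √(b / a) * Real.log (2 * √(b / a) / ε) ≤ k) :
    ((conjGrad A rhs x₀ k).val - xs) ⬝ᵥ ((conjGrad A rhs x₀ k).val - xs) ≤
      ε ^ 2 * ((x₀ - xs) ⬝ᵥ (x₀ - xs)) := by
  obtain ⟨p, hpk, hp0, hp⟩ := exists_residual_polynomial ha hab k
  have hpos : ∀ v : Fin n → ℝ, v ≠ 0 → 0 < v ⬝ᵥ A.mulVec v := by
    intro v hv
    refine lt_of_lt_of_le (mul_pos ha ?_) (hlow v)
    refine lt_of_le_of_ne (by simpa using dotProduct_star_self_nonneg v) fun h => hv ?_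
    exact dotProduct_self_eq_zero.mp h.symm
  have h1 := cg_energy_le (x₀ := x₀) hA hpos xs hxs k p hpk hp0
  have h2 := aeval_energy_le hA ha hlow hup p hp (xs - x₀)
  have h3 := hlow (xs - (cgSeq A rhs x₀ k).sol)
  rw [conjGrad_val, ← neg_sub xs, ← neg_sub xs x₀, neg_dotProduct_neg, neg_dotProduct_neg]
  set s := √(b / a) with hs
  have hspos : 0 < s := Real.sqrt_pos.mpr (div_pos (ha.trans hab) ha)
  have hs2 : s ^ 2 = b / a := Real.sq_sqrt (div_pos (ha.trans hab) ha).le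
  -- The factor s = √(b/a) comes from bounding the energy below by a and above by b times the
  -- squared Euclidean norm.
  have h4 : s * (2 * Real.exp (-(k / s))) ≤ ε := by
    have h5 : Real.log (2 * s / ε) ≤ k / s := by
      rw [le_div_iff₀ hspos]; linarith
    have h6 : 2 * s / ε ≤ Real.exp (k / s) := (Real.log_le_iff_le_exp (by positivity)).mp h5
    rw [div_le_iff₀ hε] at h6
    rw [Real.exp_neg, ← div_eq_mul_inv, ← mul_div_assoc, div_le_iff₀ (Real.exp_pos _)]
    linarith
  have h7 : (s * (2 * Real.exp (-(k / s)))) ^ 2 ≤ ε ^ 2 :=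
    pow_le_pow_left₀ (by positivity) h4 2
  rw [mul_pow, hs2] at h7
  have h8 : 0 ≤ (xs - x₀) ⬝ᵥ (xs - x₀) := by simpa using dotProduct_star_self_nonneg (xs - x₀)
  have h9 : (xs - (cgSeq A rhs x₀ k).sol) ⬝ᵥ (xs - (cgSeq A rhs x₀ k).sol) ≤
      b / a * (2 * Real.exp (-(k / s))) ^ 2 * ((xs - x₀) ⬝ᵥ (xs - x₀)) := by
    have h10 := (h3.trans h1).trans h2
    rw [← le_div_iff₀' ha] at h10
    refine h10.trans (le_of_eq ?_)
    ring
  exact h9.trans (mul_le_mul_of_nonneg_right h7 h8)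

end Spectral

end

noncomputable section

/-! ### One-dimensional band-limited test functions -/

section TestFunctions

open MeasureTheory Set
open scoped Convolution

/-- The indicator function of `[-1/2, 1/2]`. -/
def boxFn : ℝ → ℂ := Set.indicator (Icc (-(1 / 2)) (1 / 2)) 1

/-- The hat function `max (0, 1 - |t|)`. -/
def hatFn (t : ℝ) : ℂ := ((max 0 (1 - |t|) : ℝ) : ℂ)

/-- The cubic spline `hat ⋆ hat`. -/
def splineFn : ℝ → ℂ := hatFn ⋆[ContinuousLinearMap.mul ℂ ℂ] hatFn

theorem integrable_boxFn : Integrable boxFn :=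
  (integrable_indicator_iff measurableSet_Icc).mpr
    (integrableOn_const (by simp) (by simp))

theorem fourier_boxFn (ξ : ℝ) : 𝓕 boxFn ξ = (Real.sinc (Real.pi * ξ) : ℂ) := by
  rw [Real.fourier_real_eq_integral_exp_smul]
  have h1 : ∀ v : ℝ, Complex.exp (↑(-2 * Real.pi * v * ξ) * Complex.I) • boxFn v =
      Set.indicator (Icc (-(1 / 2)) (1 / 2))
        (fun v : ℝ => Complex.exp ((-2 * Real.pi * ξ * Complex.I) * v)) v := by
    intro v
    by_cases hv : v ∈ Icc (-(1 / 2) : ℝ) (1 / 2)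
    · rw [boxFn, indicator_of_mem hv, indicator_of_mem hv, Pi.one_apply, smul_eq_mul, mul_one]
      congr 1; push_cast; ring
    · rw [boxFn, indicator_of_notMem hv, indicator_of_notMem hv, smul_zero]
  simp_rw [h1]
  rw [integral_indicator measurableSet_Icc, integral_Icc_eq_integral_Ioc,
    ← intervalIntegral.integral_of_le (by norm_num)]
  by_cases hξ : ξ = 0
  · subst hξ
    norm_num
  · have hπ : (Real.pi : ℂ) ≠ 0 := by exact_mod_cast Real.pi_ne_zero
    have hξ' : (ξ : ℂ) ≠ 0 := by exact_mod_cast hξ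
    have hc : (-2 * Real.pi * ξ * Complex.I : ℂ) ≠ 0 := by simp [hπ, hξ']
    rw [integral_exp_mul_complex hc, Real.sinc_of_ne_zero (mul_ne_zero Real.pi_ne_zero hξ)]
    push_cast
    rw [Complex.sin, show (-2 * Real.pi * ξ * Complex.I : ℂ) * (1 / 2) =
      -(Real.pi * ξ) * Complex.I by ring,
      show (-2 * Real.pi * ξ * Complex.I : ℂ) * -(1 / 2) = Real.pi * ξ * Complex.I by ring]
    field_simp
    ring_nf
    rw [Complex.I_sq]
    ring

theorem boxFn_convolution : boxFn ⋆[ContinuousLinearMap.mul ℂ ℂ] boxFn = hatFn := by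
  ext t
  rw [convolution_def]
  have h1 : ∀ s : ℝ, ContinuousLinearMap.mul ℂ ℂ (boxFn s) (boxFn (t - s)) =
      Set.indicator (Icc (max (-(1 / 2)) (t - 1 / 2)) (min (1 / 2) (t + 1 / 2))) 1 s := by
    intro s
    simp only [ContinuousLinearMap.mul_apply', boxFn, indicator_apply, Pi.one_apply, mem_Icc,
      max_le_iff, le_min_iff]
    split_ifs <;> first | (exfalso; grind) | simp
  simp_rw [h1]
  simp only [integral_indicator measurableSet_Icc, Pi.one_apply, setIntegral_const,
    Real.volume_real_Icc, Complex.real_smul, mul_one, hatFn]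
  congr 1
  rw [max_comm]
  congr 1
  rcases abs_cases t with ⟨h, h'⟩ | ⟨h, h'⟩
  · rw [h, min_eq_left (by linarith), max_eq_right (by linarith)]; ring
  · rw [h, min_eq_right (by linarith), max_eq_left (by linarith)]; ring

theorem continuous_hatFn : Continuous hatFn := by unfold hatFn; fun_prop

theorem hatFn_eq_zero {t : ℝ} (ht : 1 ≤ |t|) : hatFn t = 0 := by
  rw [hatFn, max_eq_left (by linarith), Complex.ofReal_zero]

theorem hatFn_zero : hatFn 0 = 1 := by simp [hatFn]

theorem hasCompactSupport_hatFn : HasCompactSupport hatFn := by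
  refine HasCompactSupport.intro (isCompact_Icc (a := -1) (b := 1)) fun t ht => hatFn_eq_zero ?_
  by_contra h
  exact ht (abs_le.mp (not_le.mp h).le)

theorem integrable_hatFn : Integrable hatFn :=
  continuous_hatFn.integrable_of_hasCompactSupport hasCompactSupport_hatFn

theorem fourier_hatFn (ξ : ℝ) : 𝓕 hatFn ξ = ((Real.sinc (Real.pi * ξ) ^ 2 : ℝ) : ℂ) := by
  rw [← boxFn_convolution, Real.fourier_mul_convolution_eq integrable_boxFn integrable_boxFn,
    fourier_boxFn]
  push_cast
  ring

theorem fourier_splineFn (ξ : ℝ) : 𝓕 splineFn ξ = ((Real.sinc (Real.pi * ξ) ^ 4 : ℝ) : ℂ) := by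
  rw [splineFn, Real.fourier_mul_convolution_eq integrable_hatFn integrable_hatFn, fourier_hatFn]
  push_cast
  ring

theorem continuous_splineFn : Continuous splineFn :=
  hasCompactSupport_hatFn.continuous_convolution_right _ integrable_hatFn.locallyIntegrable
    continuous_hatFn

theorem integrable_splineFn : Integrable splineFn :=
  integrable_hatFn.integrable_convolution _ integrable_hatFn

theorem splineFn_eq_zero {t : ℝ} (ht : 2 ≤ |t|) : splineFn t = 0 := by
  rw [splineFn, convolution_def]
  refine integral_eq_zero_of_ae (Filter.Eventually.of_forall fun s => ?_)
  change hatFn s * hatFn (t - s) = 0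
  rcases le_total 1 |s| with h | h
  · rw [hatFn_eq_zero h, zero_mul]
  · rw [hatFn_eq_zero (t := t - s), mul_zero]
    have := abs_sub_abs_le_abs_sub t s
    linarith

theorem splineFn_zero : splineFn 0 = 2 / 3 := by
  rw [splineFn, convolution_def]
  have h1 : ∀ s : ℝ, ContinuousLinearMap.mul ℂ ℂ (hatFn s) (hatFn (0 - s)) =
      (((max 0 (1 - |s|)) ^ 2 : ℝ) : ℂ) := by
    intro s
    rw [ContinuousLinearMap.mul_apply', zero_sub, hatFn, hatFn, abs_neg]
    push_cast
    ring
  simp_rw [h1]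
  rw [integral_complex_ofReal, integral_comp_abs (f := fun s : ℝ => (max 0 (1 - s)) ^ 2)]
  have h2 : ∫ s in Ioi (0 : ℝ), (max 0 (1 - s)) ^ 2 = ∫ s in Ioc (0 : ℝ) 1, (1 - s) ^ 2 := by
    rw [setIntegral_eq_of_subset_of_forall_sdiff_eq_zero measurableSet_Ioi
      (Ioc_subset_Ioi_self : Ioc (0 : ℝ) 1 ⊆ Ioi 0)]
    · refine setIntegral_congr_fun measurableSet_Ioc fun s hs => ?_
      rw [max_eq_right (by linarith [hs.2])]
    · intro s hs
      have : 1 < s := by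
        by_contra h
        exact hs.2 ⟨hs.1, not_lt.mp h⟩
      rw [max_eq_left (by linarith)]
      norm_num
  rw [h2, ← intervalIntegral.integral_of_le zero_le_one,
    intervalIntegral.integral_comp_sub_left (fun x : ℝ => x ^ 2) 1]
  simp
  norm_num

/-! ### Integrability and inverse transforms of powers of sinc. -/

theorem mul_sinc (x : ℝ) : x * Real.sinc x = Real.sin x := by
  by_cases hx : x = 0
  · simp [hx]
  · rw [Real.sinc_of_ne_zero hx]; field_simp

theorem sinc_sq_le_one (x : ℝ) : Real.sinc x ^ 2 ≤ 1 := by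
  rw [← sq_abs]
  exact pow_le_one₀ (abs_nonneg _) (Real.abs_sinc_le_one x)

theorem integrable_sinc_sq : Integrable fun ξ : ℝ => Real.sinc (Real.pi * ξ) ^ 2 := by
  refine (integrable_inv_one_add_sq.const_mul 2).mono'
    (Continuous.aestronglyMeasurable (by have := Real.continuous_sinc; fun_prop))
    (Filter.Eventually.of_forall fun ξ => ?_)
  rw [Real.norm_eq_abs, abs_of_nonneg (sq_nonneg _), ← div_eq_mul_inv,
    le_div_iff₀ (by positivity)]
  have h1 := sinc_sq_le_one (Real.pi * ξ)
  have h2 : (Real.pi * ξ) ^ 2 * Real.sinc (Real.pi * ξ) ^ 2 ≤ 1 := by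
    rw [← mul_pow, mul_sinc]
    exact Real.sin_sq_le_one _
  have h3 : ξ ^ 2 ≤ (Real.pi * ξ) ^ 2 := by
    rw [mul_pow]
    have : 1 ≤ Real.pi ^ 2 := by nlinarith [Real.pi_gt_three]
    nlinarith [sq_nonneg ξ]
  nlinarith [mul_le_mul_of_nonneg_right h3 (sq_nonneg (Real.sinc (Real.pi * ξ)))]

theorem sinc_pow_four_le (x : ℝ) : Real.sinc x ^ 4 ≤ Real.sinc x ^ 2 := by
  have := sinc_sq_le_one x
  nlinarith [sq_nonneg (Real.sinc x)]

theorem integrable_sinc_pow_four : Integrable fun ξ : ℝ => Real.sinc (Real.pi * ξ) ^ 4 := by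
  refine integrable_sinc_sq.mono'
    (Continuous.aestronglyMeasurable (by have := Real.continuous_sinc; fun_prop))
    (Filter.Eventually.of_forall fun ξ => ?_)
  rw [Real.norm_eq_abs, abs_of_nonneg (by positivity)]
  exact sinc_pow_four_le _

/-- Two sinc factors absorb the weight ξ², which leaves a function dominated by sinc² and, through
sin², a second difference in physical space. -/
theorem sq_mul_sinc_pow_four (ξ : ℝ) : ξ ^ 2 * Real.sinc (Real.pi * ξ) ^ 4 =
    Real.sinc (Real.pi * ξ) ^ 2 * (Real.sin (Real.pi * ξ) ^ 2 / Real.pi ^ 2) := by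
  rw [← mul_sinc (Real.pi * ξ)]
  have := Real.pi_ne_zero
  field_simp

theorem integrable_sq_mul_sinc_pow_four :
    Integrable fun ξ : ℝ => ξ ^ 2 * Real.sinc (Real.pi * ξ) ^ 4 := by
  refine (integrable_sinc_sq.div_const (Real.pi ^ 2)).mono'
    (Continuous.aestronglyMeasurable (by have := Real.continuous_sinc; fun_prop))
    (Filter.Eventually.of_forall fun ξ => ?_)
  rw [Real.norm_eq_abs, abs_of_nonneg (by positivity), sq_mul_sinc_pow_four, mul_div_assoc']
  have := Real.sin_sq_le_one (Real.pi * ξ)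
  gcongr
  nlinarith [sq_nonneg (Real.sinc (Real.pi * ξ))]

theorem integral_exp_mul_sinc_sq (t : ℝ) :
    ∫ ξ : ℝ, Complex.exp (↑(2 * Real.pi * ξ * t) * Complex.I) *
      ((Real.sinc (Real.pi * ξ) ^ 2 : ℝ) : ℂ) = hatFn t := by
  have hF : 𝓕 hatFn = fun ξ => ((Real.sinc (Real.pi * ξ) ^ 2 : ℝ) : ℂ) := funext fourier_hatFn
  have h := congrFun (continuous_hatFn.fourierInv_fourier_eq integrable_hatFn
    (by rw [hF]; exact integrable_sinc_sq.ofReal)) t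
  rw [← h, Real.fourierInv_eq', hF]
  refine integral_congr_ae (Filter.Eventually.of_forall fun ξ => ?_)
  simp only [smul_eq_mul, RCLike.inner_apply, conj_trivial]
  congr 3
  push_cast
  ring

theorem integral_exp_mul_sinc_pow_four (t : ℝ) :
    ∫ ξ : ℝ, Complex.exp (↑(2 * Real.pi * ξ * t) * Complex.I) *
      ((Real.sinc (Real.pi * ξ) ^ 4 : ℝ) : ℂ) = splineFn t := by
  have hF : 𝓕 splineFn = fun ξ => ((Real.sinc (Real.pi * ξ) ^ 4 : ℝ) : ℂ) :=
    funext fourier_splineFn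
  have h := congrFun (continuous_splineFn.fourierInv_fourier_eq integrable_splineFn
    (by rw [hF]; exact integrable_sinc_pow_four.ofReal)) t
  rw [← h, Real.fourierInv_eq', hF]
  refine integral_congr_ae (Filter.Eventually.of_forall fun ξ => ?_)
  simp only [smul_eq_mul, RCLike.inner_apply, conj_trivial]
  congr 3
  push_cast
  ring

/-- The negative second derivative of the spline, divided by `4 π²`. -/
def splineDeriv (t : ℝ) : ℂ := (2 * hatFn t - hatFn (t + 1) - hatFn (t - 1)) / (4 * Real.pi ^ 2)

theorem splineDeriv_eq_zero {t : ℝ} (ht : 2 ≤ |t|) : splineDeriv t = 0 := by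
  have h1 : 1 ≤ |t + 1| := by
    have := abs_sub_abs_le_abs_sub t (-1)
    rw [sub_neg_eq_add, abs_neg, abs_one] at this
    linarith
  have h2 : 1 ≤ |t - 1| := by
    have := abs_sub_abs_le_abs_sub t 1
    rw [abs_one] at this
    linarith
  rw [splineDeriv, hatFn_eq_zero h1, hatFn_eq_zero h2, hatFn_eq_zero (by linarith)]
  simp

theorem splineDeriv_zero : splineDeriv 0 = 1 / (2 * Real.pi ^ 2) := by
  have hπ : (Real.pi : ℂ) ≠ 0 := by exact_mod_cast Real.pi_ne_zero
  rw [splineDeriv, hatFn_zero, hatFn_eq_zero (by simp), hatFn_eq_zero (by simp)]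
  field_simp
  norm_num

theorem integrable_exp_mul {g : ℝ → ℝ} (hg : Integrable g) (t : ℝ) :
    Integrable fun ξ : ℝ => Complex.exp (↑(2 * Real.pi * ξ * t) * Complex.I) * (g ξ : ℂ) := by
  refine hg.ofReal.bdd_mul (c := 1)
    (Continuous.aestronglyMeasurable (by fun_prop)) (Filter.Eventually.of_forall fun ξ => ?_)
  rw [Complex.norm_exp_ofReal_mul_I]

/-- Since 4 sin²(πξ) = 2 - exp(2πiξ) - exp(-2πiξ), the factor sin² acts as a second difference with
unit step on the hat function, the inverse transform of sinc². -/
theorem integral_exp_mul_sq_mul_sinc_pow_four (t : ℝ) :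
    ∫ ξ : ℝ, Complex.exp (↑(2 * Real.pi * ξ * t) * Complex.I) *
      ((ξ ^ 2 * Real.sinc (Real.pi * ξ) ^ 4 : ℝ) : ℂ) = splineDeriv t := by
  have hI := integrable_exp_mul integrable_sinc_sq
  have hsplit : ∀ ξ : ℝ, Complex.exp (↑(2 * Real.pi * ξ * t) * Complex.I) *
      ((ξ ^ 2 * Real.sinc (Real.pi * ξ) ^ 4 : ℝ) : ℂ) =
      (2 * (Complex.exp (↑(2 * Real.pi * ξ * t) * Complex.I) *
          ((Real.sinc (Real.pi * ξ) ^ 2 : ℝ) : ℂ)) -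
        Complex.exp (↑(2 * Real.pi * ξ * (t + 1)) * Complex.I) *
          ((Real.sinc (Real.pi * ξ) ^ 2 : ℝ) : ℂ) -
        Complex.exp (↑(2 * Real.pi * ξ * (t - 1)) * Complex.I) *
          ((Real.sinc (Real.pi * ξ) ^ 2 : ℝ) : ℂ)) / (4 * Real.pi ^ 2) := by
    intro ξ
    have hπ : (Real.pi : ℂ) ≠ 0 := by exact_mod_cast Real.pi_ne_zero
    have e1 : Complex.exp (↑(2 * Real.pi * ξ * (t + 1)) * Complex.I) =
        Complex.exp (↑(2 * Real.pi * ξ * t) * Complex.I) *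
          Complex.exp (Real.pi * ξ * Complex.I) ^ 2 := by
      rw [← Complex.exp_nat_mul, ← Complex.exp_add]; congr 1; push_cast; ring
    have e2 : Complex.exp (↑(2 * Real.pi * ξ * (t - 1)) * Complex.I) =
        Complex.exp (↑(2 * Real.pi * ξ * t) * Complex.I) *
          Complex.exp (-(Real.pi * ξ) * Complex.I) ^ 2 := by
      rw [← Complex.exp_nat_mul, ← Complex.exp_add]; congr 1; push_cast; ring
    have e3 : Complex.exp (Real.pi * ξ * Complex.I) * Complex.exp (-(Real.pi * ξ) * Complex.I) = 1 := by
      rw [← Complex.exp_add, neg_mul, add_neg_cancel, Complex.exp_zero]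
    rw [sq_mul_sinc_pow_four, e1, e2]
    push_cast
    rw [Complex.sin]
    -- Only zw = 1 is used about the two exponentials; what remains is polynomial algebra.
    generalize Complex.exp (Real.pi * ξ * Complex.I) = z at *
    generalize Complex.exp (-(Real.pi * ξ) * Complex.I) = w at *
    field_simp
    rw [Complex.I_sq]
    linear_combination (8 * (Real.sinc (Real.pi * ξ) : ℂ) ^ 2) * e3
  simp_rw [hsplit]
  have hsub : Integrable fun ξ : ℝ => 2 * (Complex.exp (↑(2 * Real.pi * ξ * t) * Complex.I) *
        ((Real.sinc (Real.pi * ξ) ^ 2 : ℝ) : ℂ)) -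
      Complex.exp (↑(2 * Real.pi * ξ * (t + 1)) * Complex.I) *
        ((Real.sinc (Real.pi * ξ) ^ 2 : ℝ) : ℂ) := ((hI t).const_mul 2).sub (hI (t + 1))
  rw [integral_div, integral_sub hsub (hI (t - 1)),
    integral_sub ((hI t).const_mul 2) (hI (t + 1)), integral_const_mul,
    integral_exp_mul_sinc_sq, integral_exp_mul_sinc_sq, integral_exp_mul_sinc_sq, splineDeriv]

end TestFunctions

end

noncomputable section

/-! ### Cosine transforms and quadratic forms -/

section CosineTransform

open MeasureTheory Set

variable {d : ℕ}

/-- The cosine transform `∫ G(ξ) cos (2π ⟪ξ, x⟫) dξ`. -/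
def cosTransform (G : EuclideanSpace ℝ (Fin d) → ℝ) (x : EuclideanSpace ℝ (Fin d)) : ℝ :=
  ∫ ξ, G ξ * Real.cos (2 * Real.pi * inner ℝ ξ x)

theorem integrable_mul_cos {G : EuclideanSpace ℝ (Fin d) → ℝ} (hG : Integrable G)
    (x : EuclideanSpace ℝ (Fin d)) :
    Integrable fun ξ => G ξ * Real.cos (2 * Real.pi * inner ℝ ξ x) := by
  refine hG.mul_bdd (c := 1) (Continuous.aestronglyMeasurable (by fun_prop))
    (Filter.Eventually.of_forall fun ξ => ?_)
  rw [Real.norm_eq_abs]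
  exact Real.abs_cos_le_one _

theorem cosTransform_zero (G : EuclideanSpace ℝ (Fin d) → ℝ) : cosTransform G 0 = ∫ ξ, G ξ := by
  simp [cosTransform]

theorem abs_cosTransform_le {G : EuclideanSpace ℝ (Fin d) → ℝ} (hG : Integrable G)
    (hG0 : ∀ ξ, 0 ≤ G ξ) (x : EuclideanSpace ℝ (Fin d)) :
    |cosTransform G x| ≤ cosTransform G 0 := by
  rw [cosTransform_zero, cosTransform, ← Real.norm_eq_abs]
  refine norm_integral_le_of_norm_le hG (Filter.Eventually.of_forall fun ξ => ?_)
  rw [Real.norm_eq_abs, abs_mul, abs_of_nonneg (hG0 ξ)]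
  exact mul_le_of_le_one_right (hG0 ξ) (Real.abs_cos_le_one _)

/-- The square of the modulus of `∑ c_i exp (2πi ⟪ξ, y_i⟫)`. -/
def expSumSq {n : ℕ} (c : Fin n → ℝ) (y : Fin n → EuclideanSpace ℝ (Fin d))
    (ξ : EuclideanSpace ℝ (Fin d)) : ℝ :=
  (∑ i, c i * Real.cos (2 * Real.pi * inner ℝ ξ (y i))) ^ 2 +
    (∑ i, c i * Real.sin (2 * Real.pi * inner ℝ ξ (y i))) ^ 2

theorem expSumSq_nonneg {n : ℕ} (c : Fin n → ℝ) (y : Fin n → EuclideanSpace ℝ (Fin d))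
    (ξ : EuclideanSpace ℝ (Fin d)) : 0 ≤ expSumSq c y ξ := by
  unfold expSumSq
  positivity

theorem expSumSq_eq {n : ℕ} (c : Fin n → ℝ) (y : Fin n → EuclideanSpace ℝ (Fin d))
    (ξ : EuclideanSpace ℝ (Fin d)) :
    expSumSq c y ξ =
      ∑ i, ∑ j, c i * c j * Real.cos (2 * Real.pi * inner ℝ ξ (y i - y j)) := by
  rw [expSumSq, sq, sq, Finset.sum_mul_sum, Finset.sum_mul_sum, ← Finset.sum_add_distrib]
  refine Finset.sum_congr rfl fun i _ => ?_
  rw [← Finset.sum_add_distrib]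
  refine Finset.sum_congr rfl fun j _ => ?_
  rw [inner_sub_right, mul_sub, Real.cos_sub]
  ring

theorem mul_expSumSq_eq {n : ℕ} (G : EuclideanSpace ℝ (Fin d) → ℝ) (c : Fin n → ℝ)
    (y : Fin n → EuclideanSpace ℝ (Fin d)) (ξ : EuclideanSpace ℝ (Fin d)) :
    G ξ * expSumSq c y ξ =
      ∑ i, ∑ j, c i * c j * (G ξ * Real.cos (2 * Real.pi * inner ℝ ξ (y i - y j))) := by
  rw [expSumSq_eq, Finset.mul_sum]
  refine Finset.sum_congr rfl fun i _ => ?_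
  rw [Finset.mul_sum]
  exact Finset.sum_congr rfl fun j _ => by ring

theorem integrable_mul_expSumSq {n : ℕ} {G : EuclideanSpace ℝ (Fin d) → ℝ} (hG : Integrable G)
    (c : Fin n → ℝ) (y : Fin n → EuclideanSpace ℝ (Fin d)) :
    Integrable fun ξ => G ξ * expSumSq c y ξ := by
  simp_rw [mul_expSumSq_eq]
  exact integrable_finsetSum _ fun i _ => integrable_finsetSum _ fun j _ =>
    (integrable_mul_cos hG _).const_mul _

theorem sum_cosTransform {n : ℕ} {G : EuclideanSpace ℝ (Fin d) → ℝ} (hG : Integrable G)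
    (c : Fin n → ℝ) (y : Fin n → EuclideanSpace ℝ (Fin d)) :
    ∑ i, ∑ j, c i * c j * cosTransform G (y i - y j) = ∫ ξ, G ξ * expSumSq c y ξ := by
  simp_rw [mul_expSumSq_eq]
  rw [integral_finsetSum _ fun i _ => integrable_finsetSum _ fun j _ =>
    (integrable_mul_cos hG _).const_mul _]
  refine Finset.sum_congr rfl fun i _ => ?_
  rw [integral_finsetSum _ fun j _ => (integrable_mul_cos hG _).const_mul _]
  refine Finset.sum_congr rfl fun j _ => ?_
  rw [integral_const_mul, cosTransform]

/-- If `H ≤ F` and the cosine transform of `H` vanishes at all differences of distinct points, then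
the quadratic form of `F` is bounded below by a multiple of the identity. -/
theorem le_sum_cosTransform {n : ℕ} {F H : EuclideanSpace ℝ (Fin d) → ℝ} (hF : Integrable F)
    (hH : Integrable H) (hHF : ∀ ξ, H ξ ≤ F ξ) (c : Fin n → ℝ)
    (y : Fin n → EuclideanSpace ℝ (Fin d))
    (hy : ∀ i j, i ≠ j → cosTransform H (y i - y j) = 0) :
    cosTransform H 0 * (c ⬝ᵥ c) ≤ ∑ i, ∑ j, c i * c j * cosTransform F (y i - y j) := by
  have h1 : ∑ i, ∑ j, c i * c j * cosTransform H (y i - y j) = cosTransform H 0 * (c ⬝ᵥ c) := by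
    rw [dotProduct, Finset.mul_sum]
    refine Finset.sum_congr rfl fun i _ => ?_
    rw [Finset.sum_eq_single i]
    · rw [sub_self]; ring
    · intro j _ hij
      rw [hy i j hij.symm, mul_zero]
    · simp
  rw [← h1, sum_cosTransform hF, sum_cosTransform hH]
  exact integral_mono (integrable_mul_expSumSq hH c y) (integrable_mul_expSumSq hF c y)
    fun ξ => mul_le_mul_of_nonneg_right (hHF ξ) (expSumSq_nonneg c y ξ)

/-! ### Tensor-product test functions on ℝ^d. -/

theorem integrable_prod_coord {g : Fin d → ℝ → ℝ} (hg : ∀ i, Integrable (g i)) :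
    Integrable fun ξ : EuclideanSpace ℝ (Fin d) => ∏ i, g i (ξ i) := by
  rw [← (PiLp.volume_preserving_toLp (Fin d)).integrable_comp_emb
    (MeasurableEquiv.toLp 2 _).measurableEmbedding]
  exact Integrable.fintype_prod hg

/-- The cosine is the real part of an exponential, which factors over the coordinates; Fubini does
the rest. -/
theorem cosTransform_prod_coord {g : Fin d → ℝ → ℝ} (hg : ∀ i, Integrable (g i))
    (x : EuclideanSpace ℝ (Fin d)) :
    cosTransform (fun ξ : EuclideanSpace ℝ (Fin d) => ∏ i, g i (ξ i)) x =
      (∏ i, ∫ t : ℝ, Complex.exp (↑(2 * Real.pi * t * x i) * Complex.I) * (g i t : ℂ)).re := by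
  rw [← integral_fintype_prod_volume_eq_prod
    (f := fun i (t : ℝ) => Complex.exp (↑(2 * Real.pi * t * x i) * Complex.I) * (g i t : ℂ)),
    cosTransform, ← (PiLp.volume_preserving_toLp (Fin d)).integral_comp
    (MeasurableEquiv.toLp 2 _).measurableEmbedding]
  have hint : Integrable fun v : Fin d → ℝ =>
      ∏ i, Complex.exp (↑(2 * Real.pi * v i * x i) * Complex.I) * (g i (v i) : ℂ) :=
    Integrable.fintype_prod (f := fun i (t : ℝ) =>
      Complex.exp (↑(2 * Real.pi * t * x i) * Complex.I) * (g i t : ℂ))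
      fun i => integrable_exp_mul (hg i) (x i)
  rw [← RCLike.re_eq_complex_re, ← integral_re hint]
  refine integral_congr_ae (Filter.Eventually.of_forall fun v => ?_)
  simp only [RCLike.re_eq_complex_re]
  rw [Finset.prod_mul_distrib, ← Complex.exp_sum, ← Finset.sum_mul, ← Complex.ofReal_prod,
    ← Complex.ofReal_sum, Complex.re_mul_ofReal, Complex.exp_ofReal_mul_I_re, mul_comm]
  congr 2
  simp only [PiLp.inner_apply, RCLike.inner_apply, conj_trivial]
  rw [Finset.mul_sum]
  exact Finset.sum_congr rfl fun i _ => by ring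

/-- The tensor product of the one-dimensional test functions. -/
def tensorTest (ξ : EuclideanSpace ℝ (Fin d)) : ℝ := ∏ i, Real.sinc (Real.pi * ξ i) ^ 4

/-- The function `(R² - ‖ξ‖²) P(ξ)` with the tensor product `P` of the one-dimensional test
functions. -/
def ballTest (R : ℝ) (ξ : EuclideanSpace ℝ (Fin d)) : ℝ := (R ^ 2 - ‖ξ‖ ^ 2) * tensorTest ξ

theorem tensorTest_nonneg (ξ : EuclideanSpace ℝ (Fin d)) : 0 ≤ tensorTest ξ :=
  Finset.prod_nonneg fun i _ => by positivity

theorem tensorTest_le_one (ξ : EuclideanSpace ℝ (Fin d)) : tensorTest ξ ≤ 1 :=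
  Finset.prod_le_one (fun i _ => by positivity)
    fun i _ => (sinc_pow_four_le _).trans (sinc_sq_le_one _)

/-- The one-dimensional factors of `ξ_j² P(ξ)`. -/
def tensorFactor (j i : Fin d) (t : ℝ) : ℝ :=
  if i = j then t ^ 2 * Real.sinc (Real.pi * t) ^ 4 else Real.sinc (Real.pi * t) ^ 4

theorem integrable_tensorFactor (j i : Fin d) : Integrable (tensorFactor j i) := by
  unfold tensorFactor
  split_ifs
  · exact integrable_sq_mul_sinc_pow_four
  · exact integrable_sinc_pow_four

theorem prod_tensorFactor (j : Fin d) (ξ : EuclideanSpace ℝ (Fin d)) :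
    ∏ i, tensorFactor j i (ξ i) = ξ j ^ 2 * tensorTest ξ := by
  have : ∀ i, tensorFactor j i (ξ i) =
      (if i = j then ξ i ^ 2 else 1) * Real.sinc (Real.pi * ξ i) ^ 4 := by
    intro i
    rw [tensorFactor]
    split_ifs <;> ring
  simp_rw [this]
  rw [Finset.prod_mul_distrib, tensorTest]
  simp

/-- Although ‖ξ‖² is not a product, it is a sum of coordinate squares, so the test function is a
combination of tensor products. -/
theorem ballTest_eq (R : ℝ) (ξ : EuclideanSpace ℝ (Fin d)) :
    ballTest R ξ = R ^ 2 * tensorTest ξ - ∑ j, ∏ i, tensorFactor j i (ξ i) := by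
  simp_rw [prod_tensorFactor]
  rw [ballTest, EuclideanSpace.norm_sq_eq, ← Finset.sum_mul]
  simp only [Real.norm_eq_abs, sq_abs]
  ring

theorem integrable_tensorTest : Integrable (tensorTest (d := d)) :=
  integrable_prod_coord fun _ => integrable_sinc_pow_four

theorem integrable_ballTest (R : ℝ) : Integrable (ballTest (d := d) R) := by
  simp_rw [funext (ballTest_eq (d := d) R)]
  exact (integrable_tensorTest.const_mul _).sub
    (integrable_finsetSum _ fun j _ => integrable_prod_coord fun i => integrable_tensorFactor j i)

theorem cosTransform_tensorTest (x : EuclideanSpace ℝ (Fin d)) :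
    cosTransform tensorTest x = (∏ i, splineFn (x i)).re := by
  have := cosTransform_prod_coord (g := fun _ t => Real.sinc (Real.pi * t) ^ 4)
    (fun _ : Fin d => integrable_sinc_pow_four) x
  simp_rw [integral_exp_mul_sinc_pow_four] at this
  exact this

theorem cosTransform_tensorFactor (j : Fin d) (x : EuclideanSpace ℝ (Fin d)) :
    cosTransform (fun ξ : EuclideanSpace ℝ (Fin d) => ∏ i, tensorFactor j i (ξ i)) x =
      (∏ i, if i = j then splineDeriv (x i) else splineFn (x i)).re := by
  rw [cosTransform_prod_coord (integrable_tensorFactor j)]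
  congr 1
  refine Finset.prod_congr rfl fun i _ => ?_
  by_cases h : i = j
  · simp only [tensorFactor, if_pos h]
    exact integral_exp_mul_sq_mul_sinc_pow_four (x i)
  · simp only [tensorFactor, if_neg h]
    exact integral_exp_mul_sinc_pow_four (x i)

theorem cosTransform_ballTest (R : ℝ) (x : EuclideanSpace ℝ (Fin d)) :
    cosTransform (ballTest R) x = R ^ 2 * (∏ i, splineFn (x i)).re -
      ∑ j, (∏ i, if i = j then splineDeriv (x i) else splineFn (x i)).re := by
  simp_rw [← cosTransform_tensorFactor]
  rw [← cosTransform_tensorTest]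
  have hI : ∀ j : Fin d, Integrable fun ξ : EuclideanSpace ℝ (Fin d) =>
      ∏ i, tensorFactor j i (ξ i) := fun j => integrable_prod_coord (integrable_tensorFactor j)
  simp only [cosTransform]
  rw [← integral_const_mul, ← integral_finsetSum _ fun j _ => integrable_mul_cos (hI j) x,
    ← integral_sub ((integrable_mul_cos integrable_tensorTest x).const_mul _)
      (integrable_finsetSum _ fun j _ => integrable_mul_cos (hI j) x)]
  refine integral_congr_ae (Filter.Eventually.of_forall fun ξ => ?_)
  simp only [ballTest_eq, ← Finset.sum_mul]
  ring

/-- Converts Euclidean distance into a coordinate outside the open support interval (-2, 2) of the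
splines; this is the source of the separation 2√d. -/
theorem exists_two_le_abs_coord (hd : 1 ≤ d) {x : EuclideanSpace ℝ (Fin d)}
    (hx : 2 * √(d : ℝ) ≤ ‖x‖) : ∃ i, 2 ≤ |x i| := by
  by_contra! h
  have h1 : ‖x‖ ^ 2 < 4 * d := by
    have : Nonempty (Fin d) := ⟨⟨0, hd⟩⟩
    rw [EuclideanSpace.norm_sq_eq]
    calc ∑ i, ‖x i‖ ^ 2 < ∑ _i : Fin d, (4 : ℝ) := by
          refine Finset.sum_lt_sum_of_nonempty Finset.univ_nonempty fun i _ => ?_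
          rw [Real.norm_eq_abs]
          nlinarith [h i, abs_nonneg (x i)]
      _ = 4 * d := by simp [mul_comm]
  have h2 : (2 * √(d : ℝ)) ^ 2 ≤ ‖x‖ ^ 2 := pow_le_pow_left₀ (by positivity) hx 2
  rw [mul_pow, Real.sq_sqrt (Nat.cast_nonneg d)] at h2
  linarith

theorem cosTransform_ballTest_eq_zero (hd : 1 ≤ d) (R : ℝ) {x : EuclideanSpace ℝ (Fin d)}
    (hx : 2 * √(d : ℝ) ≤ ‖x‖) : cosTransform (ballTest R) x = 0 := by
  obtain ⟨i, hi⟩ := exists_two_le_abs_coord hd hx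
  rw [cosTransform_ballTest, Finset.prod_eq_zero (Finset.mem_univ i) (splineFn_eq_zero hi)]
  rw [Finset.sum_eq_zero]
  · simp
  · intro j _
    rw [Finset.prod_eq_zero (Finset.mem_univ i), Complex.zero_re]
    rw [splineFn_eq_zero hi, splineDeriv_eq_zero hi, ite_self]

theorem cosTransform_ballTest_zero (hd : 1 ≤ d) (R : ℝ) :
    cosTransform (ballTest (d := d) R) 0 =
      (2 / 3) ^ (d - 1) * (R ^ 2 * (2 / 3) - d / (2 * Real.pi ^ 2)) := by
  rw [cosTransform_ballTest]
  have h1 : ∀ j : Fin d, (∏ i, if i = j then splineDeriv ((0 : EuclideanSpace ℝ (Fin d)) i) else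
      splineFn ((0 : EuclideanSpace ℝ (Fin d)) i)) =
      (((2 / 3) ^ (d - 1) * (1 / (2 * Real.pi ^ 2)) : ℝ) : ℂ) := by
    intro j
    simp only [PiLp.zero_apply, splineDeriv_zero, splineFn_zero]
    rw [Finset.prod_ite]
    simp only [Finset.prod_const, Finset.filter_eq', Finset.mem_univ, if_true, Finset.card_singleton,
      Finset.filter_ne', Finset.card_erase_of_mem, Finset.card_univ, Fintype.card_fin]
    push_cast
    ring
  have h2 : (∏ i, splineFn ((0 : EuclideanSpace ℝ (Fin d)) i)) = (((2 / 3) ^ d : ℝ) : ℂ) := by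
    simp [splineFn_zero, div_pow]
  simp_rw [h1, h2, Complex.ofReal_re]
  obtain ⟨e, rfl⟩ : ∃ e, d = e + 1 := ⟨d - 1, by omega⟩
  simp only [Finset.sum_const, Finset.card_univ, Fintype.card_fin, nsmul_eq_mul,
    Nat.add_sub_cancel, pow_succ]
  push_cast
  ring

theorem ballTest_le {R : ℝ} (ξ : EuclideanSpace ℝ (Fin d)) (hξ : ‖ξ‖ ≤ R) :
    ballTest R ξ ≤ R ^ 2 := by
  have h1 := tensorTest_nonneg ξ
  have h2 := tensorTest_le_one ξ
  have h3 : ‖ξ‖ ^ 2 ≤ R ^ 2 := pow_le_pow_left₀ (norm_nonneg _) hξ 2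
  rw [ballTest]
  nlinarith [sq_nonneg ‖ξ‖]

theorem ballTest_nonpos {R : ℝ} (hR : 0 ≤ R) (ξ : EuclideanSpace ℝ (Fin d)) (hξ : R ≤ ‖ξ‖) :
    ballTest R ξ ≤ 0 := by
  have h3 : R ^ 2 ≤ ‖ξ‖ ^ 2 := pow_le_pow_left₀ hR hξ 2
  exact mul_nonpos_of_nonpos_of_nonneg (by linarith) (tensorTest_nonneg ξ)

/-- A lower bound for the quadratic form of a function that is nonnegative, and bounded below on a
ball, in points of separation `2 √d`. -/
theorem le_sum_cosTransform_of_le_on_ball (hd : 1 ≤ d) {n : ℕ}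
    {F : EuclideanSpace ℝ (Fin d) → ℝ} (hF : Integrable F) (hF0 : ∀ ξ, 0 ≤ F ξ) {R m : ℝ}
    (hR : 0 < R) (hm : 0 ≤ m) (hFm : ∀ ξ, ‖ξ‖ ≤ R → m ≤ F ξ) (c : Fin n → ℝ)
    (y : Fin n → EuclideanSpace ℝ (Fin d))
    (hy : ∀ i j, i ≠ j → 2 * √(d : ℝ) ≤ ‖y i - y j‖) :
    m * ((2 / 3) ^ (d - 1) * (2 / 3 - d / (2 * Real.pi ^ 2 * R ^ 2))) * (c ⬝ᵥ c) ≤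
      ∑ i, ∑ j, c i * c j * cosTransform F (y i - y j) := by
  have hscale : ∀ x : EuclideanSpace ℝ (Fin d), cosTransform (fun ξ => m / R ^ 2 * ballTest R ξ) x =
      m / R ^ 2 * cosTransform (ballTest R) x := by
    intro x
    simp only [cosTransform, mul_assoc]
    rw [integral_const_mul]
  have hR2 : 0 < R ^ 2 := by positivity
  -- The minorant is (m/R²) times the ball test function: at most m inside the ball and at most 0
  -- outside.
  have h := le_sum_cosTransform hF ((integrable_ballTest R).const_mul (m / R ^ 2)) (fun ξ => ?_) c y
    (fun i j hij => by rw [hscale, cosTransform_ballTest_eq_zero hd R (hy i j hij), mul_zero])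
  · rw [hscale, cosTransform_ballTest_zero hd] at h
    refine le_trans (le_of_eq ?_) h
    have := Real.pi_ne_zero
    field_simp
  · rcases le_total ‖ξ‖ R with hξ | hξ
    · refine le_trans ?_ (hFm ξ hξ)
      rw [div_mul_eq_mul_div, div_le_iff₀ hR2]
      exact mul_le_mul_of_nonneg_left (ballTest_le ξ hξ) hm
    · exact (mul_nonpos_of_nonneg_of_nonpos (by positivity)
        (ballTest_nonpos hR.le ξ hξ)).trans (hF0 ξ)

end CosineTransform

end

noncomputable section

/-! ### The kernel as a cosine transform -/

section Kernel

open MeasureTheory Set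

variable {d : ℕ} {Φ : EuclideanSpace ℝ (Fin d) → ℝ} {τ cΦ CΦ : ℝ}

/-- The real part of the Fourier transform. -/
def fourierRe (Φ : EuclideanSpace ℝ (Fin d) → ℝ) (ξ : EuclideanSpace ℝ (Fin d)) : ℝ :=
  (𝓕 (fun x : EuclideanSpace ℝ (Fin d) => (Φ x : ℂ)) ξ).re

theorem fourierRe_eq (Φ : EuclideanSpace ℝ (Fin d) → ℝ) (ξ : EuclideanSpace ℝ (Fin d)) :
    fourierRe Φ ξ =
      (2 * Real.pi) ^ ((d : ℝ) / 2) * (unitaryFourier Φ ((2 * Real.pi) • ξ)).re := by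
  have hπ : 0 < 2 * Real.pi := by positivity
  rw [unitaryFourier, smul_smul, inv_mul_cancel₀ hπ.ne', one_smul, Complex.re_ofReal_mul,
    ← mul_assoc, ← Real.rpow_add hπ, neg_div, add_neg_cancel, Real.rpow_zero, one_mul, fourierRe]

namespace IsAdmissibleKernel

theorem even (h : IsAdmissibleKernel Φ τ cΦ CΦ) (x : EuclideanSpace ℝ (Fin d)) :
    Φ (-x) = Φ x := by
  obtain ⟨φ, hφ⟩ := h.radial
  rw [hφ, hφ, norm_neg]

theorem eq_zero (h : IsAdmissibleKernel Φ τ cΦ CΦ) {x : EuclideanSpace ℝ (Fin d)}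
    (hx : 1 < ‖x‖) : Φ x = 0 := by
  by_contra hne
  have := h.support_subset (subset_tsupport Φ hne)
  rw [mem_closedBall_zero_iff] at this
  linarith

theorem integrable (h : IsAdmissibleKernel Φ τ cΦ CΦ) : Integrable Φ := by
  refine h.continuous.integrable_of_hasCompactSupport ?_
  exact HasCompactSupport.intro (isCompact_closedBall 0 1) fun x hx =>
    h.eq_zero (by simpa using hx)

/-- Conjugation amounts to the substitution x ↦ -x, under which Φ is invariant. -/
theorem fourier_eq_fourierRe (h : IsAdmissibleKernel Φ τ cΦ CΦ) (ξ : EuclideanSpace ℝ (Fin d)) :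
    𝓕 (fun x : EuclideanSpace ℝ (Fin d) => (Φ x : ℂ)) ξ = (fourierRe Φ ξ : ℂ) := by
  refine (Complex.conj_eq_iff_re.mp ?_).symm
  rw [Real.fourier_eq', ← integral_conj]
  rw [← integral_neg_eq_self]
  refine integral_congr_ae (Filter.Eventually.of_forall fun x => ?_)
  simp only [smul_eq_mul, map_mul, ← Complex.exp_conj, Complex.conj_ofReal, Complex.conj_I,
    inner_neg_left, h.even]
  congr 2
  push_cast
  ring

theorem le_fourierRe (h : IsAdmissibleKernel Φ τ cΦ CΦ) (ξ : EuclideanSpace ℝ (Fin d)) :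
    (2 * Real.pi) ^ ((d : ℝ) / 2) * (cΦ * (1 + 4 * Real.pi ^ 2 * ‖ξ‖ ^ 2) ^ (-τ)) ≤
      fourierRe Φ ξ := by
  have hπ : 0 < 2 * Real.pi := by positivity
  rw [fourierRe_eq]
  refine mul_le_mul_of_nonneg_left ?_ (by positivity)
  have := h.fourier_lower ((2 * Real.pi) • ξ)
  rwa [norm_smul, Real.norm_eq_abs, abs_of_pos hπ, mul_pow,
    show (2 * Real.pi) ^ 2 = 4 * Real.pi ^ 2 by ring] at this

theorem fourierRe_nonneg (h : IsAdmissibleKernel Φ τ cΦ CΦ) (ξ : EuclideanSpace ℝ (Fin d)) :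
    0 ≤ fourierRe Φ ξ := by
  have := h.lower_pos
  exact le_trans (by positivity) (h.le_fourierRe ξ)

theorem fourierRe_le (h : IsAdmissibleKernel Φ τ cΦ CΦ) (ξ : EuclideanSpace ℝ (Fin d)) :
    fourierRe Φ ξ ≤ (2 * Real.pi) ^ ((d : ℝ) / 2) * (CΦ * (1 + ‖ξ‖ ^ 2) ^ (-τ)) := by
  have hπ : 0 < 2 * Real.pi := by positivity
  have hτ : 0 ≤ τ := le_trans (by positivity) h.tau_gt.le
  rw [fourierRe_eq]
  refine mul_le_mul_of_nonneg_left ?_ (by positivity)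
  refine (h.fourier_upper ((2 * Real.pi) • ξ)).trans
    (mul_le_mul_of_nonneg_left ?_ h.upper_pos.le)
  refine Real.rpow_le_rpow_of_nonpos (by positivity) ?_ (by linarith)
  rw [norm_smul, Real.norm_eq_abs, abs_of_pos hπ, mul_pow]
  have : 1 ≤ (2 * Real.pi) ^ 2 := by nlinarith [Real.pi_gt_three]
  nlinarith [sq_nonneg ‖ξ‖]

/-- This is where τ > d/2 enters: the upper Fourier bound decays with exponent 2τ > d, so inversion
is available. -/
theorem integrable_fourierRe (h : IsAdmissibleKernel Φ τ cΦ CΦ) : Integrable (fourierRe Φ) := by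
  have hI : Integrable fun ξ : EuclideanSpace ℝ (Fin d) =>
      (2 * Real.pi) ^ ((d : ℝ) / 2) * (CΦ * (1 + ‖ξ‖ ^ 2) ^ (-τ)) := by
    refine (Integrable.const_mul ?_ _).const_mul _
    have := integrable_rpow_neg_one_add_norm_sq (E := EuclideanSpace ℝ (Fin d)) (μ := volume)
      (r := 2 * τ) (by rw [finrank_euclideanSpace_fin]; linarith [h.tau_gt])
    simpa only [neg_mul, neg_div, mul_div_cancel_left₀ τ (two_ne_zero (α := ℝ))] using this
  refine hI.mono' ?_ (Filter.Eventually.of_forall fun ξ => ?_)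
  · have : Continuous (𝓕 (fun x : EuclideanSpace ℝ (Fin d) => (Φ x : ℂ))) :=
      VectorFourier.fourierIntegral_continuous Real.continuous_fourierChar
        (by exact continuous_inner) h.integrable.ofReal
    exact (Complex.continuous_re.comp this).aestronglyMeasurable
  · rw [Real.norm_eq_abs, abs_of_nonneg (h.fourierRe_nonneg ξ)]
    exact h.fourierRe_le ξ

theorem eq_cosTransform (h : IsAdmissibleKernel Φ τ cΦ CΦ) (x : EuclideanSpace ℝ (Fin d)) :
    Φ x = cosTransform (fourierRe Φ) x := by
  have hF : 𝓕 (fun x : EuclideanSpace ℝ (Fin d) => (Φ x : ℂ)) = fun ξ => (fourierRe Φ ξ : ℂ) :=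
    funext h.fourier_eq_fourierRe
  have hc : Continuous fun x : EuclideanSpace ℝ (Fin d) => (Φ x : ℂ) :=
    Complex.continuous_ofReal.comp h.continuous
  have hinv := congrFun (hc.fourierInv_fourier_eq h.integrable.ofReal
    (by rw [hF]; exact h.integrable_fourierRe.ofReal)) x
  rw [hF, Real.fourierInv_eq'] at hinv
  have hint : Integrable fun ξ : EuclideanSpace ℝ (Fin d) =>
      Complex.exp (↑(2 * Real.pi * inner ℝ ξ x) * Complex.I) • (fourierRe Φ ξ : ℂ) := by
    refine h.integrable_fourierRe.ofReal.bdd_mul (c := 1)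
      (Continuous.aestronglyMeasurable (by fun_prop)) (Filter.Eventually.of_forall fun ξ => ?_)
    rw [Complex.norm_exp_ofReal_mul_I]
  have hre := congrArg Complex.re hinv
  rw [Complex.ofReal_re] at hre
  rw [← hre, ← RCLike.re_eq_complex_re, ← integral_re hint, cosTransform]
  refine integral_congr_ae (Filter.Eventually.of_forall fun ξ => ?_)
  simp only [RCLike.re_eq_complex_re, smul_eq_mul]
  rw [Complex.re_mul_ofReal, Complex.exp_ofReal_mul_I_re, mul_comm]

theorem abs_le (h : IsAdmissibleKernel Φ τ cΦ CΦ) (x : EuclideanSpace ℝ (Fin d)) :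
    |Φ x| ≤ Φ 0 := by
  rw [h.eq_cosTransform x, h.eq_cosTransform 0]
  exact abs_cosTransform_le h.integrable_fourierRe h.fourierRe_nonneg x

theorem smul_eq_cosTransform (h : IsAdmissibleKernel Φ τ cΦ CΦ) {ρ : ℝ} (hρ : 0 < ρ)
    (x : EuclideanSpace ℝ (Fin d)) :
    Φ (ρ⁻¹ • x) = cosTransform (fun ξ => ρ ^ d * fourierRe Φ (ρ • ξ)) x := by
  rw [h.eq_cosTransform, cosTransform, cosTransform]
  have hch := Measure.integral_comp_smul volume (fun ξ : EuclideanSpace ℝ (Fin d) =>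
    fourierRe Φ ξ * Real.cos (2 * Real.pi * inner ℝ ξ (ρ⁻¹ • x))) ρ
  rw [finrank_euclideanSpace_fin, abs_of_pos (by positivity), smul_eq_mul] at hch
  have hρd : ρ ^ d ≠ 0 := by positivity
  rw [← mul_right_inj' (inv_ne_zero hρd), ← hch]
  simp only [mul_assoc]
  rw [integral_const_mul, inv_mul_cancel_left₀ hρd]
  refine integral_congr_ae (Filter.Eventually.of_forall fun ξ => ?_)
  simp only [inner_smul_left, inner_smul_right, conj_trivial]
  rw [inv_mul_cancel_left₀ hρ.ne']

end IsAdmissibleKernel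

end Kernel

/-! ### The constants -/

/-- This is the inequality d ≤ M_d raised to the power d + 1. From d to d + 2 the right side grows
by 144(d/2 + 1)² = 36(d + 2)², the left side by (d + 2)²(1 + 2/d)^(d+1), and (1 + 2/d)^(d+1) ≤ 9 · 3
< 36. -/
theorem gamma_pow_bound (d : ℕ) (hd : 1 ≤ d) :
    (d : ℝ) ^ (d + 1) ≤ 12 ^ (d + 1) * (Real.pi * Real.Gamma ((d : ℝ) / 2 + 1) ^ 2 / 9) := by
  induction d using Nat.twoStepInduction with
  | zero => omega
  | one =>
    have h : Real.Gamma ((1 : ℕ) / 2 + 1 : ℝ) = √Real.pi / 2 := by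
      rw [Real.Gamma_add_one (by norm_num)]
      push_cast
      rw [Real.Gamma_one_half_eq]
      ring
    rw [h, div_pow, Real.sq_sqrt Real.pi_pos.le]
    norm_num
    nlinarith [Real.pi_gt_three]
  | more d ih _ =>
    -- The case of dimension 2 is checked directly, since the induction hypothesis is void at 0.
    rcases Nat.eq_zero_or_pos d with rfl | hd0
    · have h : Real.Gamma (((0 + 2 : ℕ) : ℝ) / 2 + 1) = 1 := by
        norm_num
      rw [h]
      norm_num
      nlinarith [Real.pi_gt_three]
    · have ih := ih hd0
      have hdpos : (0 : ℝ) < d := by exact_mod_cast hd0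
      have h : Real.Gamma (((d + 2 : ℕ) : ℝ) / 2 + 1) =
          ((d : ℝ) / 2 + 1) * Real.Gamma ((d : ℝ) / 2 + 1) := by
        rw [← Real.Gamma_add_one (by positivity)]
        congr 1
        push_cast
        ring
      have h2 : (1 + 2 / (d : ℝ)) ^ d ≤ 9 := by
        have h3 : (1 + 2 / (d : ℝ)) ^ d ≤ Real.exp 2 := by
          calc (1 + 2 / (d : ℝ)) ^ d ≤ Real.exp (2 / d) ^ d := by
                refine pow_le_pow_left₀ (by positivity) ?_ d
                linarith [Real.add_one_le_exp (2 / (d : ℝ))]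
            _ = Real.exp 2 := by rw [← Real.exp_nat_mul]; congr 1; field_simp
        refine h3.trans ?_
        rw [show (2 : ℝ) = 1 + 1 by norm_num, Real.exp_add]
        nlinarith [Real.exp_one_lt_three, Real.exp_pos 1]
      have h4 : 1 + 2 / (d : ℝ) ≤ 3 := by
        have : 2 / (d : ℝ) ≤ 2 := div_le_self zero_le_two (by exact_mod_cast hd0)
        linarith
      have h5 : ((d : ℝ) + 2) ^ (d + 1) ≤ 36 * (d : ℝ) ^ (d + 1) := by
        have h6 : ((d : ℝ) + 2) = d * (1 + 2 / d) := by field_simp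
        rw [h6, mul_pow, mul_comm, pow_succ (1 + 2 / (d : ℝ))]
        refine mul_le_mul_of_nonneg_right ?_ (by positivity)
        have h7 : 0 < 1 + 2 / (d : ℝ) := by positivity
        nlinarith
      rw [h]
      push_cast
      calc ((d : ℝ) + 2) ^ (d + 2 + 1) = ((d : ℝ) + 2) ^ 2 * ((d : ℝ) + 2) ^ (d + 1) := by ring
        _ ≤ ((d : ℝ) + 2) ^ 2 * (36 * (d : ℝ) ^ (d + 1)) := by gcongr
        _ ≤ ((d : ℝ) + 2) ^ 2 * (36 * (12 ^ (d + 1) *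
            (Real.pi * Real.Gamma ((d : ℝ) / 2 + 1) ^ 2 / 9))) := by gcongr
        _ = _ := by ring

theorem le_constM (d : ℕ) (hd : 1 ≤ d) : (d : ℝ) ≤ constM d := by
  have hΓ : 0 < Real.Gamma ((d : ℝ) / 2 + 1) := Real.Gamma_pos_of_pos (by positivity)
  have hpos : 0 ≤ Real.pi * Real.Gamma ((d : ℝ) / 2 + 1) ^ 2 / 9 := by positivity
  refine le_of_pow_le_pow_left₀ (n := d + 1) (by omega) (by unfold constM; positivity) ?_
  rw [constM, mul_pow, ← Real.rpow_natCast (_ ^ _) (d + 1), ← Real.rpow_mul hpos]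
  push_cast
  rw [one_div_mul_cancel (by positivity), Real.rpow_one]
  exact gamma_pow_bound d hd

theorem constM_pos (d : ℕ) (hd : 1 ≤ d) : 0 < constM d :=
  lt_of_lt_of_le (by exact_mod_cast hd) (le_constM d hd)

theorem constC_pos (d : ℕ) (hd : 1 ≤ d) : 0 < constC d := by
  have hΓ : 0 < Real.Gamma ((d : ℝ) / 2 + 1) := Real.Gamma_pos_of_pos (by positivity)
  have := constM_pos d hd
  unfold constC
  positivity

theorem stabConst_pos {d : ℕ} (hd : 1 ≤ d) {cΦ : ℝ} (hc : 0 < cΦ) (τ ν cq : ℝ) :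
    0 < stabConst d cΦ τ ν cq := by
  have := constC_pos d hd
  unfold stabConst
  positivity

end

noncomputable section

/-! ### Separated points -/

section Packing

open MeasureTheory

variable {d n : ℕ}

/-- Volume comparison: the balls of radius q around the points are disjoint and lie in the ball of
radius δ + q around z. -/
theorem card_mul_pow_le_of_separated {x : Fin n → EuclideanSpace ℝ (Fin d)} {q δ : ℝ}
    (hq : 0 < q) (hδ : 0 ≤ δ) (hx : ∀ i j, i ≠ j → 2 * q ≤ ‖x i - x j‖) (S : Finset (Fin n))
    (z : EuclideanSpace ℝ (Fin d)) (hS : ∀ i ∈ S, dist (x i) z ≤ δ) :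
    (S.card : ℝ) * q ^ d ≤ (δ + q) ^ d := by
  have hdisj : (S : Set (Fin n)).PairwiseDisjoint fun i => Metric.ball (x i) q := by
    intro i _ j _ hij
    refine Metric.ball_disjoint_ball ?_
    rw [dist_eq_norm]
    linarith [hx i j hij]
  have hsub : (⋃ i ∈ S, Metric.ball (x i) q) ⊆ Metric.ball z (δ + q) := by
    refine Set.iUnion₂_subset fun i hi => Metric.ball_subset_ball' ?_
    linarith [hS i hi]
  have h1 : ∀ (w : EuclideanSpace ℝ (Fin d)) (r : ℝ), 0 < r → volume.real (Metric.ball w r) =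
      r ^ d * volume.real (Metric.ball (0 : EuclideanSpace ℝ (Fin d)) 1) := by
    intro w r hr
    rw [measureReal_def, Measure.addHaar_ball_of_pos _ _ hr, finrank_euclideanSpace_fin,
      ENNReal.toReal_mul, ENNReal.toReal_ofReal (by positivity), measureReal_def]
  have h2 : 0 < volume.real (Metric.ball (0 : EuclideanSpace ℝ (Fin d)) 1) :=
    ENNReal.toReal_pos (Metric.measure_ball_pos _ _ one_pos).ne' measure_ball_lt_top.ne
  have h3 := measureReal_mono (μ := volume) hsub measure_ball_lt_top.ne
  rw [measureReal_biUnion_finset hdisj (fun _ _ => measurableSet_ball)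
    (fun _ _ => measure_ball_lt_top.ne)] at h3
  simp_rw [h1 _ q hq, h1 z (δ + q) (by linarith)] at h3
  rw [Finset.sum_const, nsmul_eq_mul, ← mul_assoc] at h3
  exact le_of_mul_le_mul_right h3 h2

theorem card_filter_dist_le {x : Fin n → EuclideanSpace ℝ (Fin d)} {q δ σ : ℝ}
    (hq : 0 < q) (hδ : 0 ≤ δ) (hδq : δ ≤ σ * q) (hx : ∀ i j, i ≠ j → 2 * q ≤ ‖x i - x j‖)
    (i : Fin n) :
    ((Finset.univ.filter fun j => dist (x j) (x i) ≤ δ).card : ℝ) ≤ (1 + σ) ^ d := by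
  have h := card_mul_pow_le_of_separated hq hδ hx
    (Finset.univ.filter fun j => dist (x j) (x i) ≤ δ) (x i) (fun j hj => by simpa using hj)
  rw [← le_div_iff₀ (by positivity), ← div_pow] at h
  refine h.trans (pow_le_pow_left₀ (by positivity) ?_ d)
  rw [div_le_iff₀ hq]
  linarith

end Packing

/-! ### Bounds for the interpolation matrices -/

section KernelMatrix

variable {d n : ℕ} {Φ : EuclideanSpace ℝ (Fin d) → ℝ} {τ cΦ CΦ : ℝ}

/-- The factor in the lower bound of the smallest eigenvalue that does not depend on the kernel. -/
def spectralConst (d : ℕ) (σ : ℝ) : ℝ :=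
  (σ * √(d : ℝ)) ^ d * (2 * Real.pi) ^ ((d : ℝ) / 2) * ((2 / 3) ^ (d - 1) / 6) / constC d

theorem spectralConst_pos (hd : 1 ≤ d) {σ : ℝ} (hσ : 0 < σ) : 0 < spectralConst d σ := by
  have h1 := constC_pos d hd
  have h2 : 0 < √(d : ℝ) := Real.sqrt_pos.mpr (by exact_mod_cast hd)
  unfold spectralConst
  positivity

theorem kernelMatrix_isHermitian (h : IsAdmissibleKernel Φ τ cΦ CΦ) (δ : ℝ)
    (x : Fin n → EuclideanSpace ℝ (Fin d)) : (kernelMatrix Φ δ x).IsHermitian := by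
  ext i j
  rw [Matrix.conjTranspose_apply, kernelMatrix, Matrix.of_apply, Matrix.of_apply, star_trivial,
    scaledKernel, scaledKernel, ← neg_sub (x i), smul_neg, h.even]

theorem dotProduct_kernelMatrix (δ : ℝ) (x : Fin n → EuclideanSpace ℝ (Fin d)) (c : Fin n → ℝ) :
    c ⬝ᵥ (kernelMatrix Φ δ x).mulVec c =
      ∑ i, ∑ j, c i * c j * kernelMatrix Φ δ x i j := by
  simp only [dotProduct, Matrix.mulVec, Finset.mul_sum]
  exact Finset.sum_congr rfl fun i _ => Finset.sum_congr rfl fun j _ => by ring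

/-- The points are dilated by ρ/δ to reach separation 2√d and the kernel is rescaled by ρ
accordingly. The dilated density is then bounded below on a ball and compared with the ball test
function. Only the factor δ^(-d) depends on the level. -/
theorem kernelMatrix_lower_bound (hd : 1 ≤ d) (h : IsAdmissibleKernel Φ τ cΦ CΦ) {ν cq q δ : ℝ}
    (hσ : 0 < ν * cq) (hδ : 0 < δ) (hδq : δ ≤ ν * cq * q)
    {x : Fin n → EuclideanSpace ℝ (Fin d)} (hx : ∀ i j, i ≠ j → 2 * q ≤ ‖x i - x j‖)
    (c : Fin n → ℝ) :
    (δ ^ d)⁻¹ * (spectralConst d (ν * cq) / stabConst d cΦ τ ν cq) * (c ⬝ᵥ c) ≤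
      c ⬝ᵥ (kernelMatrix Φ δ x).mulVec c := by
  have hC := constC_pos d hd
  have hM := constM_pos d hd
  have hcΦ := h.lower_pos
  have hτ : 0 ≤ τ := le_trans (by positivity) h.tau_gt.le
  have hd0 : (0 : ℝ) < d := by exact_mod_cast hd
  have hsd : 0 < √(d : ℝ) := Real.sqrt_pos.mpr hd0
  have hsd2 : √(d : ℝ) ^ 2 = d := Real.sq_sqrt hd0.le
  have hπ := Real.pi_pos
  -- 2q·ρ/δ ≥ 2√d because δ ≤ ν·cq·q.
  set ρ := ν * cq * √(d : ℝ) with hρ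
  have hρ0 : 0 < ρ := by positivity
  -- Chosen so that 4π²ρ²R² = 4 M_d² ν² cq², which makes the Fourier lower bound on the ball the
  -- weight `w` occurring in `stabConst`.
  set R := constM d / (Real.pi * √(d : ℝ)) with hR
  have hR0 : 0 < R := by positivity
  set w := 1 + 4 * constM d ^ 2 * ν ^ 2 * cq ^ 2 with hw
  have hw0 : 0 < w := by positivity
  set m := ρ ^ d * ((2 * Real.pi) ^ ((d : ℝ) / 2) * (cΦ * w ^ (-τ))) with hm
  have hm0 : 0 < m := by positivity
  have hF : MeasureTheory.Integrable fun ξ : EuclideanSpace ℝ (Fin d) =>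
      ρ ^ d * fourierRe Φ (ρ • ξ) :=
    (h.integrable_fourierRe.comp_smul hρ0.ne').const_mul _
  have hmain := le_sum_cosTransform_of_le_on_ball hd hF
    (fun ξ => mul_nonneg (by positivity) (h.fourierRe_nonneg _)) hR0 hm0.le
    (fun ξ hξ => ?_) c (fun i => (ρ / δ) • x i) (fun i j hij => ?_)
  · have hentry : ∀ i j, kernelMatrix Φ δ x i j = (δ ^ d)⁻¹ *
        cosTransform (fun ξ => ρ ^ d * fourierRe Φ (ρ • ξ)) ((ρ / δ) • x i - (ρ / δ) • x j) := by
      intro i j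
      rw [kernelMatrix, Matrix.of_apply, scaledKernel, ← h.smul_eq_cosTransform hρ0, ← smul_sub,
        smul_smul]
      congr 3
      field_simp
    rw [dotProduct_kernelMatrix]
    simp_rw [hentry, mul_left_comm _ (δ ^ d)⁻¹, ← Finset.mul_sum]
    rw [mul_assoc]
    refine mul_le_mul_of_nonneg_left (le_trans (mul_le_mul_of_nonneg_right ?_ ?_) hmain)
      (by positivity)
    · have hR2 : (d : ℝ) / (2 * Real.pi ^ 2 * R ^ 2) ≤ 1 / 2 := by
        have h1 : 2 * Real.pi ^ 2 * R ^ 2 = 2 * constM d ^ 2 / d := by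
          rw [hR, div_pow, mul_pow, hsd2]
          field_simp
        rw [h1, div_div_eq_mul_div, div_le_div_iff₀ (by positivity) two_pos]
        have := le_constM d hd
        nlinarith
      have h2 : spectralConst d (ν * cq) / stabConst d cΦ τ ν cq =
          m * ((2 / 3) ^ (d - 1) * (1 / 6)) := by
        rw [spectralConst, stabConst, ← hρ, ← hw, hm, Real.rpow_neg hw0.le]
        have : w ^ τ ≠ 0 := by positivity
        field_simp
      rw [h2]
      gcongr
      linarith
    · simpa using dotProduct_star_self_nonneg c
  · rw [hm]
    refine mul_le_mul_of_nonneg_left (le_trans ?_ (h.le_fourierRe (ρ • ξ))) (by positivity)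
    gcongr _ * (_ * ?_)
    refine Real.rpow_le_rpow_of_nonpos (by positivity) ?_ (by linarith)
    rw [hw, norm_smul, Real.norm_eq_abs, abs_of_pos hρ0, mul_pow]
    have h1 : ‖ξ‖ ^ 2 ≤ R ^ 2 := pow_le_pow_left₀ (norm_nonneg _) hξ 2
    have h2 : 4 * Real.pi ^ 2 * (ρ ^ 2 * R ^ 2) = 4 * constM d ^ 2 * ν ^ 2 * cq ^ 2 := by
      rw [hρ, hR, div_pow, mul_pow, mul_pow, mul_pow, hsd2]
      field_simp
    rw [← h2]
    gcongr
  · rw [← smul_sub, norm_smul, Real.norm_eq_abs, abs_of_pos (by positivity), hρ,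
      div_mul_eq_mul_div, le_div_iff₀ hδ]
    have h1 := hx i j hij
    calc 2 * √(d : ℝ) * δ ≤ 2 * √(d : ℝ) * (ν * cq * q) := by gcongr
      _ = ν * cq * √(d : ℝ) * (2 * q) := by ring
      _ ≤ _ := by gcongr

theorem kernelMatrix_eq_zero (h : IsAdmissibleKernel Φ τ cΦ CΦ) {δ : ℝ} (hδ : 0 < δ)
    {x : Fin n → EuclideanSpace ℝ (Fin d)} {i j : Fin n} (hij : ¬ dist (x j) (x i) ≤ δ) :
    kernelMatrix Φ δ x i j = 0 := by
  rw [kernelMatrix, Matrix.of_apply, scaledKernel, h.eq_zero, mul_zero]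
  rw [norm_smul, norm_inv, Real.norm_eq_abs, abs_of_pos hδ, ← dist_eq_norm, dist_comm,
    inv_mul_eq_div, one_lt_div hδ]
  exact not_le.mp hij

theorem length_sparseRows_le (h : IsAdmissibleKernel Φ τ cΦ CΦ) {q δ σ : ℝ} (hq : 0 < q)
    (hδ : 0 < δ) (hδq : δ ≤ σ * q) {x : Fin n → EuclideanSpace ℝ (Fin d)}
    (hx : ∀ i j, i ≠ j → 2 * q ≤ ‖x i - x j‖) (i : Fin n) :
    (sparseRows (kernelMatrix Φ δ x) i).length ≤ ⌊(1 + σ) ^ d⌋₊ := by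
  classical
  refine Nat.le_floor (le_trans ?_ (card_filter_dist_le hq hδ.le hδq hx i))
  rw [sparseRows, List.length_map,
    ← List.toFinset_card_of_nodup ((List.nodup_finRange n).filter _)]
  refine Nat.cast_le.mpr (Finset.card_le_card fun j hj => ?_)
  rw [List.mem_toFinset, List.mem_filter] at hj
  rw [Finset.mem_filter]
  refine ⟨Finset.mem_univ _, ?_⟩
  by_contra hne
  exact (of_decide_eq_true hj.2) (kernelMatrix_eq_zero h hδ hne)

/-- A symmetric matrix is bounded by its largest absolute row sum. Each row has at most (1 + σ)^d
nonzero entries, each at most δ^(-d) B in modulus. -/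
theorem kernelMatrix_upper_bound (h : IsAdmissibleKernel Φ τ cΦ CΦ) {B q δ σ : ℝ} (hB : Φ 0 ≤ B)
    (hq : 0 < q) (hδ : 0 < δ) (hδq : δ ≤ σ * q) {x : Fin n → EuclideanSpace ℝ (Fin d)}
    (hx : ∀ i j, i ≠ j → 2 * q ≤ ‖x i - x j‖) (c : Fin n → ℝ) :
    c ⬝ᵥ (kernelMatrix Φ δ x).mulVec c ≤ (δ ^ d)⁻¹ * ((1 + σ) ^ d * B) * (c ⬝ᵥ c) := by
  set A := kernelMatrix Φ δ x with hA
  have hB0 : 0 ≤ B := (abs_nonneg _).trans ((h.abs_le 0).trans hB)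
  have hsymm : ∀ i j, A i j = A j i := fun i j => by
    have := (kernelMatrix_isHermitian h δ x).apply i j
    rw [star_trivial] at this
    exact this.symm
  have hrow : ∀ i, ∑ j, |A i j| ≤ (δ ^ d)⁻¹ * ((1 + σ) ^ d * B) := by
    intro i
    calc ∑ j, |A i j| ≤ ∑ j, if dist (x j) (x i) ≤ δ then (δ ^ d)⁻¹ * B else 0 := by
          refine Finset.sum_le_sum fun j _ => ?_
          split_ifs with hij
          · rw [hA, kernelMatrix, Matrix.of_apply, scaledKernel, abs_mul,
              abs_of_pos (by positivity : 0 < (δ ^ d)⁻¹)]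
            exact mul_le_mul_of_nonneg_left ((h.abs_le _).trans hB) (by positivity)
          · rw [hA, kernelMatrix_eq_zero h hδ hij, abs_zero]
      _ = ((Finset.univ.filter fun j => dist (x j) (x i) ≤ δ).card : ℝ) * ((δ ^ d)⁻¹ * B) := by
          rw [← Finset.sum_filter, Finset.sum_const, nsmul_eq_mul]
      _ ≤ (1 + σ) ^ d * ((δ ^ d)⁻¹ * B) := by
          gcongr
          exact card_filter_dist_le hq hδ.le hδq hx i
      _ = _ := by ring
  rw [dotProduct_kernelMatrix]
  calc ∑ i, ∑ j, c i * c j * A i j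
      ≤ ∑ i, ∑ j, (|A i j| * c i ^ 2 / 2 + |A i j| * c j ^ 2 / 2) := by
        refine Finset.sum_le_sum fun i _ => Finset.sum_le_sum fun j _ => ?_
        have h1 : c i * c j * A i j ≤ |c i * c j| * |A i j| := by
          rw [← abs_mul]; exact le_abs_self _
        have h2 : |c i * c j| ≤ c i ^ 2 / 2 + c j ^ 2 / 2 := by
          rw [abs_le]
          constructor <;> nlinarith [sq_nonneg (c i + c j), sq_nonneg (c i - c j)]
        nlinarith [abs_nonneg (A i j)]
    _ = ∑ i, ∑ j, |A i j| * c i ^ 2 := by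
        have hswap : ∑ i, ∑ j, |A i j| * c j ^ 2 / 2 = ∑ i, ∑ j, |A i j| * c i ^ 2 / 2 := by
          rw [Finset.sum_comm]
          exact Finset.sum_congr rfl fun i _ => Finset.sum_congr rfl fun j _ => by rw [hsymm]
        simp_rw [Finset.sum_add_distrib]
        rw [hswap]
        simp_rw [← Finset.sum_add_distrib, add_halves]
    _ ≤ ∑ i, (δ ^ d)⁻¹ * ((1 + σ) ^ d * B) * (c i * c i) := by
        refine Finset.sum_le_sum fun i _ => ?_
        rw [← Finset.sum_mul, ← sq]
        exact mul_le_mul_of_nonneg_right (hrow i) (sq_nonneg _)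
    _ = _ := by rw [dotProduct, Finset.mul_sum]

end KernelMatrix

/-! ### Hierarchies of point sets -/

theorem two_mul_sepDist_le {d n : ℕ} (x : Fin n → EuclideanSpace ℝ (Fin d)) (i j : Fin n)
    (hij : i ≠ j) : 2 * sepDist x ≤ ‖x i - x j‖ := by
  have h := ciInf_le (Set.finite_range
    fun p : {p : Fin n × Fin n // p.1 ≠ p.2} => dist (x p.1.1) (x p.1.2)).bddBelow ⟨(i, j), hij⟩
  rw [sepDist, ← dist_eq_norm]
  linarith

theorem sepDist_nonneg {d n : ℕ} (x : Fin n → EuclideanSpace ℝ (Fin d)) : 0 ≤ sepDist x :=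
  mul_nonneg (by norm_num) (Real.iInf_nonneg fun _ => dist_nonneg)

/-- A nonempty open set in positive dimension is infinite, so it contains a point off the finite
set. -/
theorem fillDist_pos {d n : ℕ} (hd : 1 ≤ d) (hn : 1 ≤ n) (x : Fin n → EuclideanSpace ℝ (Fin d))
    {Ω : Set (EuclideanSpace ℝ (Fin d))} (hΩ : IsOpen Ω) (hne : Ω.Nonempty)
    (hb : Bornology.IsBounded Ω) (hx : ∀ i, x i ∈ Ω) : 0 < fillDist x Ω := by
  have : Nonempty (Fin d) := ⟨⟨0, hd⟩⟩
  have hrange : (Set.range x).Nonempty := ⟨x ⟨0, hn⟩, Set.mem_range_self _⟩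
  have hfin := Set.finite_range x
  obtain ⟨z, hz⟩ := hne
  have hinf : Ω.Infinite := infinite_of_mem_nhds z (hΩ.mem_nhds hz)
  obtain ⟨y, hy, hyx⟩ := (hinf.sdiff hfin).nonempty
  have hpos : 0 < Metric.infDist y (Set.range x) :=
    (hfin.isClosed.notMem_iff_infDist_pos hrange).mp hyx
  -- Needed because an unbounded real supremum takes the default value 0.
  have hbdd : BddAbove (Set.range fun y : Ω =>
      Metric.infDist (y : EuclideanSpace ℝ (Fin d)) (Set.range x)) := by
    refine ⟨Metric.diam Ω, ?_⟩
    rintro _ ⟨w, rfl⟩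
    exact (Metric.infDist_le_dist_of_mem (Set.mem_range_self ⟨0, hn⟩)).trans
      (Metric.dist_le_diam_of_mem hb w.2 (hx _))
  exact lt_of_lt_of_le hpos (le_ciSup hbdd ⟨y, hy⟩)

section Hierarchy

variable {d : ℕ} {Ω : Set (EuclideanSpace ℝ (Fin d))} {N : ℕ → ℕ}
  {X : (ℓ : ℕ) → Fin (N ℓ) → EuclideanSpace ℝ (Fin d)} {μ ch cq cs γ ν : ℝ}

namespace IsAdmissibleHierarchy

theorem one_le_card (h : IsAdmissibleHierarchy Ω N X μ ch cq cs γ ν) {ℓ : ℕ} (hℓ : 1 ≤ ℓ) :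
    1 ≤ N ℓ := by
  have h1 := h.card_lower ℓ hℓ
  have h2 := h.cs_pos
  have h3 := h.mu_mem.1
  have : (0 : ℝ) < N ℓ := lt_of_lt_of_le (by positivity) h1
  exact_mod_cast this

theorem fill_pos (hd : 1 ≤ d) (h : IsAdmissibleHierarchy Ω N X μ ch cq cs γ ν) {ℓ : ℕ}
    (hℓ : 1 ≤ ℓ) : 0 < fillDist (X ℓ) Ω :=
  fillDist_pos hd (h.one_le_card hℓ) (X ℓ) h.isOpen h.isConnected.nonempty h.isBounded (h.mem ℓ hℓ)

/-- The fill distance is positive and at most cq times the separation distance. This also rules out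
one-point levels, where the infimum over the empty set has the default value 0. -/
theorem sep_pos (hd : 1 ≤ d) (h : IsAdmissibleHierarchy Ω N X μ ch cq cs γ ν) {ℓ : ℕ}
    (hℓ : 1 ≤ ℓ) : 0 < sepDist (X ℓ) := by
  refine lt_of_le_of_ne (sepDist_nonneg _) fun h0 => ?_
  have h1 := h.fill_le_sep ℓ hℓ
  have h2 := h.fill_pos hd hℓ
  rw [← h0, mul_zero] at h1
  linarith

theorem cq_pos (hd : 1 ≤ d) (h : IsAdmissibleHierarchy Ω N X μ ch cq cs γ ν) : 0 < cq := by
  have h1 := h.fill_le_sep 1 le_rfl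
  have h2 := h.fill_pos hd le_rfl
  exact pos_of_mul_pos_left (h2.trans_le h1) (h.sep_pos hd le_rfl).le

/-- From 1 ≤ ν h₁ ≤ ν·cq·q₁. It keeps the power of q₁ inside the logarithm bounded below
independently of the point sets. -/
theorem le_sep_one (hd : 1 ≤ d) (hν : 0 < ν) (h : IsAdmissibleHierarchy Ω N X μ ch cq cs γ ν) :
    1 / (ν * cq) ≤ sepDist (X 1) := by
  have h1 := h.fill_le_sep 1 le_rfl
  have h2 := h.nu_lower
  have h3 := h.cq_pos hd
  rw [div_le_iff₀ (h.fill_pos hd le_rfl)] at h2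
  rw [div_le_iff₀ (by positivity)]
  nlinarith

end IsAdmissibleHierarchy

end Hierarchy

end

noncomputable section

/-! ### Block diagonal systems -/

theorem blockDiagonal'_mulVec_apply {ι : Type*} [Fintype ι] [DecidableEq ι] {m : ι → Type*}
    [∀ i, Fintype (m i)] (M : (i : ι) → Matrix (m i) (m i) ℝ) (v : (Σ i, m i) → ℝ)
    (i : ι) (j : m i) :
    (Matrix.blockDiagonal' M).mulVec v ⟨i, j⟩ = (M i).mulVec (fun l => v ⟨i, l⟩) j := by
  simp only [Matrix.mulVec, dotProduct, Fintype.sum_sigma]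
  rw [Finset.sum_eq_single i]
  · simp [Matrix.blockDiagonal'_apply_eq]
  · intro b _ hb
    refine Finset.sum_eq_zero fun l _ => ?_
    rw [Matrix.blockDiagonal'_apply_ne _ _ _ hb.symm, zero_mul]
  · simp

theorem existsUnique_mulVec_eq {n : ℕ} {A : Matrix (Fin n) (Fin n) ℝ} {a : ℝ} (ha : 0 < a)
    (hlow : ∀ v : Fin n → ℝ, a * (v ⬝ᵥ v) ≤ v ⬝ᵥ A.mulVec v) (b : Fin n → ℝ) :
    ∃ xs : Fin n → ℝ, ∀ y, A.mulVec y = b ↔ y = xs := by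
  have hinj : Function.Injective A.mulVec := by
    intro v w hvw
    have h1 := hlow (v - w)
    rw [Matrix.mulVec_sub, hvw, sub_self, dotProduct_zero] at h1
    have h2 : 0 ≤ (v - w) ⬝ᵥ (v - w) := by simpa using dotProduct_star_self_nonneg (v - w)
    have h3 : (v - w) ⬝ᵥ (v - w) = 0 := le_antisymm (by nlinarith) h2
    exact sub_eq_zero.mp (dotProduct_self_eq_zero.mp h3)
  have hsurj : Function.Surjective A.mulVec :=
    Matrix.mulVec_surjective_iff_isUnit.mpr (Matrix.mulVec_injective_iff_isUnit.mp hinj)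
  obtain ⟨xs, hxs⟩ := hsurj b
  exact ⟨xs, fun y => ⟨fun hy => hinj (hy.trans hxs.symm), fun hy => hy ▸ hxs⟩⟩

theorem norm_toLp_sq_sigma {ι : Type*} [Fintype ι] {m : ι → Type*} [∀ i, Fintype (m i)]
    (v : (Σ i, m i) → ℝ) :
    ‖WithLp.toLp 2 v‖ ^ 2 = ∑ i, (fun l => v ⟨i, l⟩) ⬝ᵥ (fun l => v ⟨i, l⟩) := by
  rw [EuclideanSpace.norm_sq_eq, Fintype.sum_sigma]
  simp only [dotProduct, Real.norm_eq_abs, sq_abs]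
  simp only [sq]

/-! ### The number of steps -/

/-- The number of steps needed to reduce the error by `ε` is controlled by the number of steps in
which the constants under the logarithm are replaced by comparable ones. -/
theorem exists_step_bound (d : ℕ) {κ c : ℝ} (hκ : 0 < κ) (hc : 0 < c) :
    ∃ K : ℝ, 0 ≤ K ∧ ∀ C ε T : ℝ, 1 ≤ κ * C → 0 < ε → ε < 1 → c * (C / ε) ≤ T →
      √(κ * C) * Real.log (2 * √(κ * C) / ε) + 2 ≤
        K * ((max 1 ⌈1 / 2 * √(4 ^ d * C) * Real.log T⌉₊ : ℕ) : ℝ) := by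
  set b := c / κ with hb
  have hb0 : 0 < b := by positivity
  -- The threshold from which 2z ≤ (bz)², so that log(2z) ≤ 2 log T.
  set Z := 2 / b ^ 2 with hZ
  have hZ0 : 0 < Z := by positivity
  refine ⟨4 * √κ + √Z * |Real.log (2 * Z)| + 2, by positivity, fun C ε T hC hε hε1 hT => ?_⟩
  have hC0 : 0 < C := pos_of_mul_pos_right (by linarith) hκ.le
  set y := κ * C with hy
  set z := y / ε with hz
  set W : ℝ := ((max 1 ⌈1 / 2 * √(4 ^ d * C) * Real.log T⌉₊ : ℕ) : ℝ) with hW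
  have hW1 : 1 ≤ W := by
    rw [hW]; exact_mod_cast le_max_left _ _
  have hWle : 1 / 2 * √(4 ^ d * C) * Real.log T ≤ W := by
    refine (Nat.le_ceil _).trans ?_
    rw [hW]; exact_mod_cast le_max_right _ _
  have hy0 : 0 < y := by linarith
  have hyz : y ≤ z := le_div_self hy0.le hε hε1.le
  have hbz : b * z ≤ T := by
    refine le_trans (le_of_eq ?_) hT
    rw [hb, hz, hy]
    field_simp
  have hz0 : 0 < z := by linarith
  have hsy : √y ≤ y := by
    rw [Real.sqrt_le_left hy0.le]
    nlinarith
  have hlog : Real.log (2 * √y / ε) ≤ Real.log (2 * z) := by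
    refine Real.log_le_log (by positivity) ?_
    rw [hz, mul_div_assoc]
    gcongr
  have hlog0 : 0 ≤ Real.log (2 * z) := Real.log_nonneg (by linarith)
  have h1 : √y * Real.log (2 * √y / ε) ≤ √y * Real.log (2 * z) := by gcongr
  rcases le_or_gt Z z with hzZ | hzZ
  · have h2 : 2 * z ≤ (b * z) ^ 2 := by
      rw [hZ, div_le_iff₀ (by positivity)] at hzZ
      nlinarith
    have h3 : Real.log (2 * z) ≤ 2 * Real.log T := by
      calc Real.log (2 * z) ≤ Real.log ((b * z) ^ 2) := Real.log_le_log (by positivity) h2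
        _ = 2 * Real.log (b * z) := by rw [Real.log_pow]; norm_num
        _ ≤ 2 * Real.log T := by
          have := Real.log_le_log (by positivity) hbz
          linarith
    have hT0 : 0 ≤ Real.log T := by linarith
    have h4 : √y ≤ √κ * √(4 ^ d * C) := by
      rw [hy, Real.sqrt_mul hκ.le]
      gcongr
      exact le_mul_of_one_le_left hC0.le (one_le_pow₀ (by norm_num))
    have h5 : √y * Real.log (2 * z) ≤ 4 * √κ * W := by
      calc √y * Real.log (2 * z) ≤ (√κ * √(4 ^ d * C)) * (2 * Real.log T) := by gcongr
        _ = 4 * √κ * (1 / 2 * √(4 ^ d * C) * Real.log T) := by ring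
        _ ≤ _ := by gcongr
    have h6 : 0 ≤ √Z * |Real.log (2 * Z)| * W := by positivity
    nlinarith
  -- Below the threshold y ≤ z < Z, so the left side is bounded by a constant and W ≥ 1 suffices,
  -- whatever the sign of log T.
  · have h2 : √y * Real.log (2 * z) ≤ √Z * |Real.log (2 * Z)| := by
      refine mul_le_mul (Real.sqrt_le_sqrt (by linarith)) ?_ hlog0 (Real.sqrt_nonneg _)
      exact (Real.log_le_log (by positivity) (by linarith)).trans (le_abs_self _)
    have h3 : √Z * |Real.log (2 * Z)| ≤ √Z * |Real.log (2 * Z)| * W :=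
      le_mul_of_one_le_right (by positivity) hW1
    have h4 : 0 ≤ 4 * √κ * W := by positivity
    nlinarith

theorem sum_Icc_eq_sum_fin (N : ℕ → ℕ) (L : ℕ) :
    ∑ ℓ ∈ Finset.Icc 1 L, N ℓ = ∑ ℓ : Fin L, N (ℓ + 1) := by
  rw [Fin.sum_univ_eq_sum_range (fun i => N (i + 1)) L, Finset.range_eq_Ico,
    Finset.sum_Ico_add' N 0 L 1, zero_add]
  rfl

/-- Error and cost of the blockwise method, for blocks with uniformly bounded condition numbers and
row lengths. -/
theorem blockConjGrad_bounds {d : ℕ} {Φ : EuclideanSpace ℝ (Fin d) → ℝ}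
    {Ω : Set (EuclideanSpace ℝ (Fin d))} {N : ℕ → ℕ}
    {X : (ℓ : ℕ) → Fin (N ℓ) → EuclideanSpace ℝ (Fin d)} {ν : ℝ} {L m : ℕ} {a b : ℝ}
    (ha : 0 < a) (hab : a < b) (s : ℕ → ℝ) (hs : ∀ ℓ, 1 ≤ ℓ → 0 < s ℓ)
    (hN : ∀ ℓ, 1 ≤ ℓ → 1 ≤ N ℓ)
    (hA : ∀ ℓ, 1 ≤ ℓ → (levelMatrix Φ Ω X ν ℓ).IsHermitian)
    (hlow : ∀ ℓ, 1 ≤ ℓ → ∀ v : Fin (N ℓ) → ℝ,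
      s ℓ * a * (v ⬝ᵥ v) ≤ v ⬝ᵥ (levelMatrix Φ Ω X ν ℓ).mulVec v)
    (hup : ∀ ℓ, 1 ≤ ℓ → ∀ v : Fin (N ℓ) → ℝ,
      v ⬝ᵥ (levelMatrix Φ Ω X ν ℓ).mulVec v ≤ s ℓ * b * (v ⬝ᵥ v))
    (hm : ∀ ℓ, 1 ≤ ℓ → ∀ i, (sparseRows (levelMatrix Φ Ω X ν ℓ) i).length ≤ m)
    {ε : ℝ} (hε : 0 < ε) (k : ℕ) (hk : √(b / a) * Real.log (2 * √(b / a) / ε) ≤ k)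
    (β α₀ : MultiIdx N L → ℝ) :
    ∃ αs : MultiIdx N L → ℝ,
      (∀ η : MultiIdx N L → ℝ, (blockMatrix Φ Ω X ν L).mulVec η = β ↔ η = αs) ∧
      ‖WithLp.toLp 2 ((blockConjGrad Φ Ω X ν L β α₀ k).val - αs)‖
        ≤ ε * ‖WithLp.toLp 2 (α₀ - αs)‖ ∧
      (blockConjGrad Φ Ω X ν L β α₀ k).ops ≤
        (k + 1) * (2 * m + 13) * ∑ ℓ ∈ Finset.Icc 1 L, N ℓ := by
  have hsol := fun ℓ : Fin L => existsUnique_mulVec_eq (mul_pos (hs (ℓ + 1) (by omega)) ha)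
    (hlow (ℓ + 1) (by omega)) (fun i => β ⟨ℓ, i⟩)
  choose xs hxs using hsol
  refine ⟨fun i => xs i.1 i.2, fun η => ?_, ?_, ?_⟩
  · constructor
    · intro h
      funext ⟨ℓ, i⟩
      have h1 := (hxs ℓ (fun i => η ⟨ℓ, i⟩)).mp (by
        funext i
        rw [← h, blockMatrix, blockDiagonal'_mulVec_apply])
      exact congrFun h1 i
    · rintro rfl
      funext ⟨ℓ, i⟩
      rw [blockMatrix, blockDiagonal'_mulVec_apply]
      exact congrFun ((hxs ℓ (xs ℓ)).mpr rfl) i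
  · refine le_of_sq_le_sq ?_ (by positivity)
    rw [mul_pow, norm_toLp_sq_sigma, norm_toLp_sq_sigma, Finset.mul_sum]
    refine Finset.sum_le_sum fun ℓ _ => ?_
    have hsℓ := hs (ℓ + 1) (by omega)
    -- The level-dependent scale cancels in the condition number, so one k serves all levels.
    have hquot : s (ℓ + 1) * b / (s (ℓ + 1) * a) = b / a := mul_div_mul_left _ _ hsℓ.ne'
    exact conjGrad_error_le (hA (ℓ + 1) (by omega)) (mul_pos hsℓ ha)
      (mul_lt_mul_of_pos_left hab hsℓ) (hlow (ℓ + 1) (by omega)) (hup (ℓ + 1) (by omega))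
      (fun i => β ⟨ℓ, i⟩) (fun i => α₀ ⟨ℓ, i⟩) (xs ℓ) ((hxs ℓ (xs ℓ)).mpr rfl) hε k
      (by rw [hquot]; exact hk)
  · rw [sum_Icc_eq_sum_fin, Finset.mul_sum]
    change ∑ ℓ : Fin L, (conjGrad (levelMatrix Φ Ω X ν (ℓ + 1)) (fun i => β ⟨ℓ, i⟩)
      (fun i => α₀ ⟨ℓ, i⟩) k).ops ≤ _
    refine Finset.sum_le_sum fun ℓ _ => ?_
    rw [mul_assoc]
    exact conjGrad_ops_le (hN (ℓ + 1) (by omega)) _ (hm (ℓ + 1) (by omega)) _ _ k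

end

/-! ### The main theorem: choice of constants and assembly. -/

theorem theorem3p6 (d : ℕ) (hd : 1 ≤ d) (ν cq B : ℝ) (hν : 0 < ν) :
    ∃ K : ℝ,
      ∀ (Φ : EuclideanSpace ℝ (Fin d) → ℝ) (τ cΦ CΦ : ℝ),
        IsAdmissibleKernel Φ τ cΦ CΦ → Φ 0 ≤ B →
      ∀ (Ω : Set (EuclideanSpace ℝ (Fin d))) (N : ℕ → ℕ)
        (X : (ℓ : ℕ) → Fin (N ℓ) → EuclideanSpace ℝ (Fin d)) (μ ch cs γ : ℝ),
        IsAdmissibleHierarchy Ω N X μ ch cq cs γ ν →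
      ∀ (L : ℕ), 1 ≤ L → ∀ (ε : ℝ), 0 < ε → ε < 1 →
      ∃ k : ℕ, ∀ (β α₀ : MultiIdx N L → ℝ),
        ∃ αs : MultiIdx N L → ℝ,
          (∀ η : MultiIdx N L → ℝ, (blockMatrix Φ Ω X ν L).mulVec η = β ↔ η = αs) ∧
          ‖WithLp.toLp 2 ((blockConjGrad Φ Ω X ν L β α₀ k).val - αs)‖
            ≤ ε * ‖WithLp.toLp 2 (α₀ - αs)‖ ∧
          ((blockConjGrad Φ Ω X ν L β α₀ k).ops : ℝ)
            ≤ K * ((∑ ℓ ∈ Finset.Icc 1 L, N ℓ : ℕ) : ℝ) *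
              ((max 1 ⌈1 / 2 * √(cgConst d cΦ τ ν cq) *
                Real.log (stabConst d cΦ τ ν cq * √(L : ℝ) *
                  sepDist (X 1) ^ ((d : ℝ) / 2) / ε)⌉₊ : ℕ) : ℝ) := by
  -- For cq ≤ 0 there is no admissible hierarchy, and any K works.
  by_cases hcq : 0 < cq
  swap
  · exact ⟨0, fun _ _ _ _ _ _ _ _ _ _ _ _ _ hH => absurd (hH.cq_pos hd) hcq⟩
  have hσ : 0 < ν * cq := mul_pos hν hcq
  have hS := spectralConst_pos hd hσ
  -- Keeps the spectral bound positive whatever the sign of B. The factor 2 in `b` below provides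
  -- the strict inequality a < b.
  set B' := max B 1 with hB'
  have hB'0 : 0 < B' := lt_of_lt_of_le one_pos (le_max_right _ _)
  set b := 2 * ((1 + ν * cq) ^ d * B') with hb
  have hb0 : 0 < b := by positivity
  set κ := b / spectralConst d (ν * cq) with hκ
  have hκ0 : 0 < κ := by positivity
  obtain ⟨K, hK0, hK⟩ := exists_step_bound d hκ0
    (show 0 < (1 / (ν * cq)) ^ ((d : ℝ) / 2) by positivity)
  set m := ⌊(1 + ν * cq) ^ d⌋₊ with hm
  refine ⟨K * (2 * m + 13), fun Φ τ cΦ CΦ hΦ hΦB Ω N X μ ch cs γ hH L hL ε hε hε1 => ?_⟩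
  have hC := stabConst_pos hd hΦ.lower_pos τ ν cq
  set C := stabConst d cΦ τ ν cq with hCdef
  set a := spectralConst d (ν * cq) / C with ha
  have ha0 : 0 < a := by positivity
  have hba : b / a = κ * C := by rw [ha, hκ]; field_simp
  have hδ : ∀ ℓ, 1 ≤ ℓ → 0 < ν * fillDist (X ℓ) Ω := fun ℓ hℓ => mul_pos hν (hH.fill_pos hd hℓ)
  have hδq : ∀ ℓ, 1 ≤ ℓ → ν * fillDist (X ℓ) Ω ≤ ν * cq * sepDist (X ℓ) := by
    intro ℓ hℓ
    rw [mul_assoc]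
    exact mul_le_mul_of_nonneg_left (hH.fill_le_sep ℓ hℓ) hν.le
  have hlow : ∀ ℓ, 1 ≤ ℓ → ∀ v : Fin (N ℓ) → ℝ,
      ((ν * fillDist (X ℓ) Ω) ^ d)⁻¹ * a * (v ⬝ᵥ v) ≤ v ⬝ᵥ (levelMatrix Φ Ω X ν ℓ).mulVec v :=
    fun ℓ hℓ v => kernelMatrix_lower_bound hd hΦ hσ (hδ ℓ hℓ) (hδq ℓ hℓ)
      (two_mul_sepDist_le (X ℓ)) v
  have hup' : ∀ ℓ, 1 ≤ ℓ → ∀ v : Fin (N ℓ) → ℝ, v ⬝ᵥ (levelMatrix Φ Ω X ν ℓ).mulVec v ≤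
      ((ν * fillDist (X ℓ) Ω) ^ d)⁻¹ * (b / 2) * (v ⬝ᵥ v) := by
    intro ℓ hℓ v
    rw [hb, mul_div_cancel_left₀ _ two_ne_zero]
    exact kernelMatrix_upper_bound hΦ (hΦB.trans (le_max_left _ _)) (hH.sep_pos hd hℓ) (hδ ℓ hℓ)
      (hδq ℓ hℓ) (two_mul_sepDist_le (X ℓ)) v
  have hs : ∀ ℓ, 1 ≤ ℓ → 0 < ((ν * fillDist (X ℓ) Ω) ^ d)⁻¹ := fun ℓ hℓ =>
    inv_pos.mpr (pow_pos (hδ ℓ hℓ) d)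
  have hvv : ∀ {n : ℕ} (v : Fin n → ℝ), 0 ≤ v ⬝ᵥ v := fun v => by
    simpa using dotProduct_star_self_nonneg v
  have hup : ∀ ℓ, 1 ≤ ℓ → ∀ v : Fin (N ℓ) → ℝ, v ⬝ᵥ (levelMatrix Φ Ω X ν ℓ).mulVec v ≤
      ((ν * fillDist (X ℓ) Ω) ^ d)⁻¹ * b * (v ⬝ᵥ v) := by
    intro ℓ hℓ v
    refine (hup' ℓ hℓ v).trans (mul_le_mul_of_nonneg_right
      (mul_le_mul_of_nonneg_left (by linarith) (hs ℓ hℓ).le) (hvv v))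
  -- Both form bounds are tested on a coordinate vector of the first level. This gives κC ≥ 1, as
  -- the step bound requires.
  have hab : a ≤ b / 2 := by
    have h1 := hlow 1 le_rfl (Pi.single ⟨0, hH.one_le_card le_rfl⟩ 1)
    have h2 := hup' 1 le_rfl (Pi.single ⟨0, hH.one_le_card le_rfl⟩ 1)
    have h3 := h1.trans h2
    rw [single_dotProduct, Pi.single_eq_same, mul_one, mul_one, mul_one] at h3
    exact le_of_mul_le_mul_left h3 (hs 1 le_rfl)
  have hκC : 1 ≤ κ * C := by
    rw [← hba, one_le_div ha0]
    linarith
  have hT : (1 / (ν * cq)) ^ ((d : ℝ) / 2) * (C / ε) ≤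
      C * √(L : ℝ) * sepDist (X 1) ^ ((d : ℝ) / 2) / ε := by
    have h1 : (1 / (ν * cq)) ^ ((d : ℝ) / 2) ≤ sepDist (X 1) ^ ((d : ℝ) / 2) :=
      Real.rpow_le_rpow (by positivity) (hH.le_sep_one hd hν) (by positivity)
    have h2 : 1 ≤ √(L : ℝ) := Real.one_le_sqrt.mpr (by exact_mod_cast hL)
    have h3 : 0 ≤ sepDist (X 1) ^ ((d : ℝ) / 2) := Real.rpow_nonneg (sepDist_nonneg _) _
    calc (1 / (ν * cq)) ^ ((d : ℝ) / 2) * (C / ε) ≤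
          (√(L : ℝ) * sepDist (X 1) ^ ((d : ℝ) / 2)) * (C / ε) := by
          gcongr
          exact h1.trans (le_mul_of_one_le_left h3 h2)
      _ = _ := by ring
  have hstep := hK C ε _ hκC hε hε1 hT
  set k := ⌈√(κ * C) * Real.log (2 * √(κ * C) / ε)⌉₊ with hk
  refine ⟨k, fun β α₀ => ?_⟩
  obtain ⟨αs, h1, h2, h3⟩ := blockConjGrad_bounds (L := L) ha0 (by linarith : a < b)
    (fun ℓ => ((ν * fillDist (X ℓ) Ω) ^ d)⁻¹) hs (fun ℓ hℓ => hH.one_le_card hℓ)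
    (fun ℓ _ => kernelMatrix_isHermitian hΦ _ _) hlow hup
    (fun ℓ hℓ i => length_sparseRows_le hΦ (hH.sep_pos hd hℓ) (hδ ℓ hℓ) (hδq ℓ hℓ)
      (two_mul_sepDist_le (X ℓ)) i) hε k (by rw [hba]; exact Nat.le_ceil _) β α₀
  refine ⟨αs, h1, h2, ?_⟩
  -- One unit comes from the initialization, one from rounding up; the latter needs the rounded
  -- quantity to be nonnegative, which follows from κC ≥ 1 > ε.
  have hk1 : (k : ℝ) + 1 ≤ √(κ * C) * Real.log (2 * √(κ * C) / ε) + 2 := by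
    have h4 : 1 ≤ √(κ * C) := Real.one_le_sqrt.mpr hκC
    have h5 : 0 ≤ √(κ * C) * Real.log (2 * √(κ * C) / ε) := by
      refine mul_nonneg (by positivity) (Real.log_nonneg ?_)
      rw [one_le_div hε]
      linarith
    have := Nat.ceil_lt_add_one h5
    linarith
  have h3' : ((blockConjGrad Φ Ω X ν L β α₀ k).ops : ℝ) ≤
      ((k : ℝ) + 1) * (2 * m + 13) * ((∑ ℓ ∈ Finset.Icc 1 L, N ℓ : ℕ) : ℝ) := by
    exact_mod_cast h3
  refine h3'.trans ?_
  calc ((k : ℝ) + 1) * (2 * m + 13) * ((∑ ℓ ∈ Finset.Icc 1 L, N ℓ : ℕ) : ℝ)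
      ≤ (K * ((max 1 ⌈1 / 2 * √(4 ^ d * C) * Real.log (C * √(L : ℝ) *
          sepDist (X 1) ^ ((d : ℝ) / 2) / ε)⌉₊ : ℕ) : ℝ)) * (2 * m + 13) *
          ((∑ ℓ ∈ Finset.Icc 1 L, N ℓ : ℕ) : ℝ) := by
        gcongr
        exact hk1.trans hstep
    _ = _ := by
        rw [cgConst, ← hCdef]
        ring
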